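/- Let $N\ge 1$, let $\Omega\subset\mathbb{R}^N$ be a nonempty bounded open set with diameter $R$, let $1<p<+\infty$, $0<s<1$ and $t>1$. Let $B=B_{tR}(\Omega)$ be the open ball of diameter $tR$ whose center is the center of the smallest ball containing $\Omega$. Functions in $L^p(\Omega)$ are extended by zero outside $\Omega$, and for $\sigma>0$ we put $$[u]_{\sigma}^p=\int_{B\times B}\frac{|u(x)-u(y)|^p}{|x-y|^{N+\sigma p}}\,dx\,dy\in[0,+\infty].$$ For $0<\sigma<1$ let $\widetilde W^{\sigma,p}_{0,tR}(\Omega)$ be the closure of $C_0^\infty(\Omega)$ for the seminorm $[\cdot]_\sigma$, realized in $L^p(\Omega)$: the set of all $u\in L^p(\Omega)$ for which there are $\varphi_n\in C_0^\infty(\Omega)$ with $[u-\varphi_n]_\sigma\to0$. Let $f$ belong to the dual of $\widetilde W^{s,p}_{0,tR}(\Omega)$, that is, $f$ is a linear functional on this space with $|\langle f,u\rangle|\le C[u]_s$ for some constant $C$. For $s\le\sigma<1$ (so that $\widetilde W^{\sigma,p}_{0,tR}(\Omega)\subset\widetilde W^{s,p}_{0,tR}(\Omega)$) define $F_\sigma:L^p(\Omega)\to\mathbb{R}\cup\{+\infty\}$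 by $$F_\sigma(u)=\frac1p\int_{B\times B}\frac{|u(x)-u(y)|^p}{|x-y|^{N+\sigma p}}\,dx\,dy+\langle f,u\rangle\quad\text{if }u\in\widetilde W^{\sigma,p}_{0,tR}(\Omega),\qquad F_\sigma(u)=+\infty\quad\text{otherwise},$$ where $\langle f,u\rangle$ is the duality pairing, also written $\int_\Omega fu\,dx$. Let $(s_j)_j\subset(0,1)$ be a non-increasing sequence converging to $s$. Then: 1. The sequence $(F_{s_j})_j$ is equi-coercive in $L^p(\Omega)$: there is a compact set $K\subset L^p(\Omega)$ such that $\inf_{L^p(\Omega)}F_{s_j}=\inf_{K}F_{s_j}$ for every $j$. 2. The sequence $(F_{s_j})_j$ $\Gamma$-converges to $F_s$ in $L^p(\Omega)$ at every $u\in L^p(\Omega)$ such that, for some $\epsilon>0$, $$\int_{B\times B}\frac{|u(x)-u(y)|^p}{|x-y|^{N+(s+\epsilon)p}}\,dx\,dy<+\infty .$$ That is, for every such $u$: $F_s(u)\le\liminf_{j\to\infty}F_{s_j}(u_j)$ for every sequence $u_j\to u$ in $L^p(\Omega)$, and there is a sequence $u_j\to u$ in $L^p(\Omega)$ with $\limsup_{j\to\infty}F_{s_j}(u_j)\le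 F_s(u)$. -/

import Mathlib

open MeasureTheory Filter Topology TopologicalSpace
open scoped ENNReal NNReal

namespace FracGamma

/-- Euclidean space `ℝ^N`. -/
abbrev E (N : ℕ) : Type := EuclideanSpace ℝ (Fin N)

/-- An exponent `1 < p` makes `L^p` a normed space. -/
instance factOneLe (p : ℝ) [hp : Fact (1 < p)] : Fact (1 ≤ ENNReal.ofReal p) :=
  ⟨by simpa using ENNReal.ofReal_le_ofReal hp.out.le⟩

/-- The space `L^p(Ω)`. -/
noncomputable abbrev LpOn {N : ℕ} (Ω : Opens (E N)) (p : ℝ) :=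
  Lp ℝ (ENNReal.ofReal p) ((volume : Measure (E N)).restrict (Ω : Set (E N)))

/-- The extension by zero of a function on `Ω` to the whole space. -/
noncomputable def zeroExt {N : ℕ} {Ω : Opens (E N)} {p : ℝ} (u : LpOn Ω p) : E N → ℝ :=
  (Ω : Set (E N)).indicator u

/-- `c` is the center of the smallest ball containing `Ω`. -/
def IsSmallestBallCenter {N : ℕ} (Ω : Set (E N)) (c : E N) : Prop :=
  ∃ r : ℝ, Ω ⊆ Metric.closedBall c r ∧
    ∀ (c' : E N) (r' : ℝ), Ω ⊆ Metric.closedBall c' r' → r ≤ r'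

/-- The ball of diameter `t R` centered at `c`, where `R` is the diameter of `Ω`. -/
def relBall {N : ℕ} (Ω : Opens (E N)) (c : E N) (t : ℝ) : Set (E N) :=
  Metric.ball c (t * Metric.diam (Ω : Set (E N)) / 2)

/-- The Gagliardo energy `∬_{B × B} |w(x) - w(y)|^p / |x - y|^(N + s p) dx dy ∈ [0, ∞]`. -/
noncomputable def energy {N : ℕ} (B : Set (E N)) (s p : ℝ) (w : E N → ℝ) : ℝ≥0∞ :=
  ∫⁻ z in B ×ˢ B, ENNReal.ofReal (|w z.1 - w z.2| ^ p / ‖z.1 - z.2‖ ^ ((N : ℝ) + s * p))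

/-- The test functions `C_0^∞(Ω)`: smooth functions with compact support contained in `Ω`. -/
def IsTest {N : ℕ} (Ω : Opens (E N)) (φ : E N → ℝ) : Prop :=
  ContDiff ℝ ((⊤ : ℕ∞) : WithTop ℕ∞) φ ∧ HasCompactSupport φ ∧ tsupport φ ⊆ (Ω : Set (E N))

section helpers

variable {N : ℕ} {B : Set (E N)} {s p : ℝ}

theorem energy_congr {w w' : E N → ℝ} (h : w =ᵐ[volume] w') :
    energy B s p w = energy B s p w' := by
  unfold energy
  apply lintegral_congr_ae
  apply ae_restrict_of_ae
  have h1 : ∀ᵐ z : E N × E N ∂(volume.prod volume), w z.1 = w' z.1 :=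
    Measure.quasiMeasurePreserving_fst.ae h
  have h2 : ∀ᵐ z : E N × E N ∂(volume.prod volume), w z.2 = w' z.2 :=
    Measure.quasiMeasurePreserving_snd.ae h
  rw [Measure.volume_eq_prod]
  filter_upwards [h1, h2] with z hz1 hz2
  rw [hz1, hz2]

theorem energy_add_le (hp : 1 < p) {a b : E N → ℝ} (ha : Measurable a) :
    energy B s p (fun x => a x + b x)
      ≤ ENNReal.ofReal (2 ^ (p - 1)) * (energy B s p a + energy B s p b) := by
  unfold energy
  rw [← lintegral_add_left (by fun_prop), ← lintegral_const_mul' _ _ ENNReal.ofReal_ne_top]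
  apply lintegral_mono
  intro z
  simp only
  set d : ℝ := ‖z.1 - z.2‖ ^ ((N : ℝ) + s * p)
  have hd : 0 ≤ d := Real.rpow_nonneg (norm_nonneg _) _
  rw [← ENNReal.ofReal_add (by positivity) (by positivity), ← ENNReal.ofReal_mul (by positivity)]
  apply ENNReal.ofReal_le_ofReal
  rw [← add_div, ← mul_div_assoc]
  apply div_le_div_of_nonneg_right _ hd
  have h1 : |a z.1 + b z.1 - (a z.2 + b z.2)| ≤ |a z.1 - a z.2| + |b z.1 - b z.2| := by
    have : a z.1 + b z.1 - (a z.2 + b z.2) = (a z.1 - a z.2) + (b z.1 - b z.2) := by ring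
    rw [this]
    exact abs_add_le _ _
  refine (Real.rpow_le_rpow (abs_nonneg _) h1 (by linarith)).trans ?_
  have h2 := NNReal.rpow_add_le_mul_rpow_add_rpow ⟨|a z.1 - a z.2|, abs_nonneg _⟩
    ⟨|b z.1 - b z.2|, abs_nonneg _⟩ hp.le
  exact_mod_cast h2

theorem energy_smul (c : ℝ) (a : E N → ℝ) :
    energy B s p (fun x => c * a x) = ENNReal.ofReal (|c| ^ p) * energy B s p a := by
  unfold energy
  rw [← lintegral_const_mul' _ _ ENNReal.ofReal_ne_top]
  congr 1
  funext z
  rw [← ENNReal.ofReal_mul (by positivity), ← mul_sub, abs_mul,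
    Real.mul_rpow (abs_nonneg _) (abs_nonneg _), mul_div_assoc]

theorem energy_zero (hp : 1 < p) : energy B s p (fun _ => 0) = 0 := by
  have : p ≠ 0 := by linarith
  simp [energy, Real.zero_rpow this]

variable {Ω : Opens (E N)}

theorem measurable_zeroExt (u : LpOn Ω p) : Measurable (zeroExt u) :=
  (Lp.stronglyMeasurable u).measurable.indicator Ω.isOpen.measurableSet

theorem zeroExt_add (u v : LpOn Ω p) :
    zeroExt (u + v) =ᵐ[volume] fun x => zeroExt u x + zeroExt v x := by
  filter_upwards [ae_imp_of_ae_restrict (Lp.coeFn_add u v)] with x hx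
  by_cases h : x ∈ (Ω : Set (E N))
  · simp only [zeroExt, Set.indicator_of_mem h, hx h, Pi.add_apply]
  · simp only [zeroExt, Set.indicator_of_notMem h, add_zero]

theorem zeroExt_smul (c : ℝ) (u : LpOn Ω p) :
    zeroExt (c • u) =ᵐ[volume] fun x => c * zeroExt u x := by
  filter_upwards [ae_imp_of_ae_restrict (Lp.coeFn_smul c u)] with x hx
  by_cases h : x ∈ (Ω : Set (E N))
  · simp only [zeroExt, Set.indicator_of_mem h, hx h, Pi.smul_apply, smul_eq_mul]
  · simp only [zeroExt, Set.indicator_of_notMem h, mul_zero]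

theorem zeroExt_zero : zeroExt (0 : LpOn Ω p) =ᵐ[volume] fun _ => 0 := by
  filter_upwards [ae_imp_of_ae_restrict
    (Lp.coeFn_zero ℝ (ENNReal.ofReal p) (volume.restrict (Ω : Set (E N))))] with x hx
  by_cases h : x ∈ (Ω : Set (E N))
  · simp only [zeroExt, Set.indicator_of_mem h, hx h, Pi.zero_apply]
  · simp only [zeroExt, Set.indicator_of_notMem h]

theorem IsTest.add {φ ψ : E N → ℝ} (hφ : IsTest Ω φ) (hψ : IsTest Ω ψ) :
    IsTest Ω (fun x => φ x + ψ x) :=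
  ⟨hφ.1.add hψ.1, hφ.2.1.add hψ.2.1,
    (tsupport_add φ ψ).trans (Set.union_subset hφ.2.2 hψ.2.2)⟩

theorem IsTest.smul {φ : E N → ℝ} (c : ℝ) (hφ : IsTest Ω φ) :
    IsTest Ω (fun x => c * φ x) :=
  ⟨contDiff_const.mul hφ.1, hφ.2.1.mul_left,
    (tsupport_mul_subset_right (f := fun _ => c) (g := φ)).trans hφ.2.2⟩

theorem IsTest.zero : IsTest Ω (fun _ => 0) :=
  ⟨contDiff_const, HasCompactSupport.zero, by
    have : tsupport (fun _ : E N => (0 : ℝ)) = ∅ := by rw [tsupport_eq_empty_iff]; rfl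
    rw [this]; exact Set.empty_subset _⟩

end helpers

/-- The relative-nonlocal Sobolev space of order `s`, realized in `L^p(Ω)`: the functions that
are limits of sequences in `C_0^∞(Ω)` for the seminorm `(energy (relBall Ω c t) s p ·)^(1/p)`. -/
noncomputable def relSobolev {N : ℕ} (Ω : Opens (E N)) (c : E N) (t p : ℝ) [hp : Fact (1 < p)]
    (s : ℝ) : Submodule ℝ (LpOn Ω p) where
  carrier := {u | ∃ φ : ℕ → E N → ℝ, (∀ n, IsTest Ω (φ n)) ∧
    Tendsto (fun n => energy (relBall Ω c t) s p (fun x => zeroExt u x - φ n x)) atTop (𝓝 0)}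
  zero_mem' := by
    refine ⟨fun _ _ => 0, fun _ => IsTest.zero, ?_⟩
    have : energy (relBall Ω c t) s p (fun x => zeroExt (0 : LpOn Ω p) x - 0) = 0 := by
      rw [← energy_zero (N := N) (B := relBall Ω c t) (s := s) hp.out]
      apply energy_congr
      filter_upwards [zeroExt_zero (Ω := Ω) (p := p)] with x hx
      rw [hx, sub_zero]
    simp only [this]
    exact tendsto_const_nhds
  add_mem' := by
    rintro u v ⟨φ, hφ, hu⟩ ⟨ψ, hψ, hv⟩
    refine ⟨fun n x => φ n x + ψ n x, fun n => (hφ n).add (hψ n), ?_⟩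
    have hlim := ENNReal.Tendsto.const_mul (a := ENNReal.ofReal (2 ^ (p - 1))) (hu.add hv)
      (Or.inr ENNReal.ofReal_ne_top)
    rw [add_zero, mul_zero] at hlim
    refine tendsto_of_tendsto_of_tendsto_of_le_of_le tendsto_const_nhds hlim
      (fun _ => zero_le) fun n => ?_
    refine le_trans (le_of_eq ?_) (energy_add_le hp.out
      ((measurable_zeroExt u).sub (hφ n).1.continuous.measurable))
    apply energy_congr
    filter_upwards [zeroExt_add u v] with x hx
    simp only [hx]
    ring
  smul_mem' := by
    rintro a u ⟨φ, hφ, hu⟩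
    refine ⟨fun n x => a * φ n x, fun n => (hφ n).smul a, ?_⟩
    have hlim := ENNReal.Tendsto.const_mul (a := ENNReal.ofReal (|a| ^ p)) hu
      (Or.inr ENNReal.ofReal_ne_top)
    rw [mul_zero] at hlim
    refine hlim.congr fun n => ?_
    rw [← energy_smul]
    apply energy_congr
    filter_upwards [zeroExt_smul a u] with x hx
    rw [hx]
    ring

theorem energy_mono_order {N : ℕ} {Ω : Opens (E N)} {c : E N} {t p s s' : ℝ} (hp : 1 < p)
    (h : s ≤ s') (w : E N → ℝ) :
    energy (relBall Ω c t) s p w ≤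
      ENNReal.ofReal ((t * Metric.diam (Ω : Set (E N))) ^ ((s' - s) * p)) *
        energy (relBall Ω c t) s' p w := by
  unfold energy
  rw [← lintegral_const_mul' _ _ ENNReal.ofReal_ne_top]
  refine setLIntegral_mono' (Metric.isOpen_ball.measurableSet.prod
    Metric.isOpen_ball.measurableSet) ?_
  rintro ⟨x, y⟩ ⟨hx, hy⟩
  simp only at hx hy ⊢
  have hd : ‖x - y‖ ≤ t * Metric.diam (Ω : Set (E N)) := by
    rw [← dist_eq_norm]
    have h1 := Metric.mem_ball.1 hx
    have h2 := Metric.mem_ball'.1 hy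
    linarith [dist_triangle x c y]
  have h0 : 0 ≤ t * Metric.diam (Ω : Set (E N)) := (norm_nonneg _).trans hd
  rw [← ENNReal.ofReal_mul (Real.rpow_nonneg h0 _)]
  apply ENNReal.ofReal_le_ofReal
  rcases eq_or_ne x y with rfl | hne
  · have : p ≠ 0 := by linarith
    simp [Real.zero_rpow this]
  have hpos : 0 < ‖x - y‖ := norm_pos_iff.2 (sub_ne_zero.2 hne)
  have hsplit : ‖x - y‖ ^ ((N : ℝ) + s' * p)
      = ‖x - y‖ ^ ((s' - s) * p) * ‖x - y‖ ^ ((N : ℝ) + s * p) := by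
    rw [← Real.rpow_add hpos]; congr 1; ring
  have hle : ‖x - y‖ ^ ((s' - s) * p)
      ≤ (t * Metric.diam (Ω : Set (E N))) ^ ((s' - s) * p) :=
    Real.rpow_le_rpow hpos.le hd (mul_nonneg (by linarith) (by linarith))
  have hA : 0 < ‖x - y‖ ^ ((s' - s) * p) := Real.rpow_pos_of_pos hpos _
  have hD : 0 < ‖x - y‖ ^ ((N : ℝ) + s * p) := Real.rpow_pos_of_pos hpos _
  have hnum : 0 ≤ |w x - w y| ^ p := Real.rpow_nonneg (abs_nonneg _) _
  rw [hsplit, ← mul_div_assoc, div_le_div_iff₀ hD (by positivity)]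
  nlinarith [mul_le_mul_of_nonneg_right hle (mul_nonneg hnum hD.le)]

/-- The embedding of the space of order `s'` into the space of order `s ≤ s'`. -/
theorem relSobolev_anti {N : ℕ} (Ω : Opens (E N)) (c : E N) (t p : ℝ) [hp : Fact (1 < p)]
    {s s' : ℝ} (h : s ≤ s') : relSobolev Ω c t p s' ≤ relSobolev Ω c t p s := by
  rintro u ⟨φ, hφ, hu⟩
  refine ⟨φ, hφ, ?_⟩
  have hlim := ENNReal.Tendsto.const_mul
    (a := ENNReal.ofReal ((t * Metric.diam (Ω : Set (E N))) ^ ((s' - s) * p))) hu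
    (Or.inr ENNReal.ofReal_ne_top)
  rw [mul_zero] at hlim
  exact tendsto_of_tendsto_of_tendsto_of_le_of_le tendsto_const_nhds hlim
    (fun _ => zero_le) fun n => energy_mono_order hp.out h _

/-- `f` belongs to the dual of the relative-nonlocal Sobolev space: the linear functional `f` is
bounded with respect to the norm `(energy (relBall Ω c t) s p ·)^(1/p)`. -/
def IsBoundedFunctional {N : ℕ} {Ω : Opens (E N)} {c : E N} {t p : ℝ} [Fact (1 < p)] {s : ℝ}
    (f : relSobolev Ω c t p s →ₗ[ℝ] ℝ) : Prop :=
  ∃ C : ℝ≥0, ∀ u : relSobolev Ω c t p s,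
    ENNReal.ofReal |f u| ≤ C * (energy (relBall Ω c t) s p (zeroExt u.1)) ^ (1 / p)

open Classical in
/-- The functional `F_s(u) = (1/p) ∬_{B × B} |u(x) - u(y)|^p / |x - y|^(N + s p) + ⟨f, u⟩` on
`L^p(Ω)`, equal to `+∞` outside the relative-nonlocal Sobolev space of order `s`. -/
noncomputable def functionalF {N : ℕ} {Ω : Opens (E N)} {c : E N} {t p : ℝ} [Fact (1 < p)]
    {s : ℝ} (f : relSobolev Ω c t p s →ₗ[ℝ] ℝ) (u : LpOn Ω p) : EReal :=
  if h : u ∈ relSobolev Ω c t p s then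
    ((ENNReal.ofReal (1 / p) * energy (relBall Ω c t) s p (zeroExt u) : ℝ≥0∞) : EReal)
      + ((f ⟨u, h⟩ : ℝ) : EReal)
  else ⊤

/-- Equi-coercivity: one compact set carries the infimum of every functional. -/
def EquiCoercive {X : Type*} [TopologicalSpace X] (F : ℕ → X → EReal) : Prop :=
  ∃ K : Set X, IsCompact K ∧ ∀ k, ⨅ u, F k u = ⨅ u ∈ K, F k u

/-- De Giorgi convergence of `F k` to `G` at the point `u`. -/
def GammaConvergesAt {X : Type*} [TopologicalSpace X] (F : ℕ → X → EReal) (G : X → EReal)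
    (u : X) : Prop :=
  (∀ v : ℕ → X, Tendsto v atTop (𝓝 u) → G u ≤ liminf (fun k => F k (v k)) atTop) ∧
    ∃ v : ℕ → X, Tendsto v atTop (𝓝 u) ∧ limsup (fun k => F k (v k)) atTop ≤ G u

end FracGamma

namespace FracGamma

/-! Pointwise inequalities for `|·| ^ p` -/

/-! The mechanism is monotonicity in the order plus density of test functions. On `B` one has `|x -
y| ≤ tR`, so the energy of order `s` is at most `(tR) ^ ((σ j - s) p)` times the energy of order `σ
j`, and this factor tends to 1. Since `f` is controlled by the energy of order `s` to the power `1 /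
p < 1`, a bound on the functionals bounds the energies uniformly in `j` (`exists_energy_bound`).

Compactness: `B \ Ω` has positive measure, which gives a Poincaré inequality
(`exists_poincare_const`). At bounded energy a function is determined in `L^p(B)`, up to a small
error, by finitely many averages over small balls, whence total boundedness
(`totallyBounded_energy_le`). When `N ≥ 2` and `t` is close to 1, `Ω` may stick out of `B`, where
the energy sees nothing. The functionals depend only on the values on `B` (`functionalF_congr`), so
competitors are first cut off to `B`.

Lower bound: along a sequence with small functionals, comparison of the orders puts infinitely many
terms in one sublevel set of `functionalF f`, and that set is closed in `L^p` (`isClosed_sublevel`).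
Fatou's lemma alone would not give membership of the limit in the closure of the test functions, nor
convergence of `f`. Uniform convexity of the energy supplies both, in place of weak compactness and
Mazur's lemma: near the limit, almost energy-minimizing elements of the sublevel set are close to
each other in energy.

Upper bound: a function of finite value is approximated in energy of order `s` by test functions.
The energies of a fixed test function converge as `σ j` tends to `s`, by dominated convergence, and
a diagonal choice gives the recovery sequence. -/

theorem abs_midpoint_rpow_le {p : ℝ} (hp : 1 < p) (a b : ℝ) :
    |(a + b) / 2| ^ p ≤ (|a| ^ p + |b| ^ p) / 2 := by
  have h1 : |(a + b) / 2| ≤ (1 / 2 : ℝ) • |a| + (1 / 2 : ℝ) • |b| := by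
    rw [abs_div, abs_two, smul_eq_mul, smul_eq_mul]
    linarith [abs_add_le a b]
  have h2 := (convexOn_rpow hp.le).2 (Set.mem_Ici.2 (abs_nonneg a)) (Set.mem_Ici.2 (abs_nonneg b))
    (by norm_num : (0 : ℝ) ≤ 1 / 2) (by norm_num : (0 : ℝ) ≤ 1 / 2) (by norm_num)
  refine (Real.rpow_le_rpow (abs_nonneg _) h1 (by linarith)).trans (h2.trans (le_of_eq ?_))
  simp only [smul_eq_mul]
  ring

theorem abs_midpoint_rpow_lt {p : ℝ} (hp : 1 < p) {a b : ℝ} (hab : a ≠ b) :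
    |(a + b) / 2| ^ p < (|a| ^ p + |b| ^ p) / 2 := by
  have hp0 : 0 < p := by linarith
  by_cases h : |a| = |b|
  · obtain rfl : a = -b := (abs_eq_abs.1 h).resolve_left hab
    have hb : b ≠ 0 := by rintro rfl; simp at hab
    have : 0 < |b| ^ p := Real.rpow_pos_of_pos (abs_pos.2 hb) p
    simpa [Real.zero_rpow hp0.ne'] using this
  · have h1 : |(a + b) / 2| ≤ (1 / 2 : ℝ) • |a| + (1 / 2 : ℝ) • |b| := by
      rw [abs_div, abs_two, smul_eq_mul, smul_eq_mul]
      linarith [abs_add_le a b]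
    have h2 := (strictConvexOn_rpow hp).2 (Set.mem_Ici.2 (abs_nonneg a))
      (Set.mem_Ici.2 (abs_nonneg b)) h
      (by norm_num : (0 : ℝ) < 1 / 2) (by norm_num : (0 : ℝ) < 1 / 2) (by norm_num)
    refine (Real.rpow_le_rpow (abs_nonneg _) h1 hp0.le).trans_lt (h2.trans_le (le_of_eq ?_))
    simp only [smul_eq_mul]
    ring

/-- A form of uniform convexity valid for all `p > 1` at once, which avoids the two Clarkson cases.
Both sides are homogeneous of degree `p`, so the unit sphere suffices; there strict convexity has a
positive gap on the compact set where `|a - b| ^ p ≥ ε`, and elsewhere the `ε` term absorbs `|a - b|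
^ p`. Being linear in the `p`-th powers, it can be integrated directly. -/
theorem exists_uniform_convexity_rpow {p : ℝ} (hp : 1 < p) {ε : ℝ} (hε : 0 < ε) :
    ∃ K : ℝ, 0 ≤ K ∧ ∀ a b : ℝ,
      |a - b| ^ p + K * |(a + b) / 2| ^ p ≤ (ε + K / 2) * (|a| ^ p + |b| ^ p) := by
  have hp0 : 0 < p := by linarith
  have hcont : ∀ g : ℝ × ℝ → ℝ, Continuous g → Continuous fun z => |g z| ^ p := fun g hg =>
    hg.abs.rpow_const fun _ => Or.inr hp0.le
  have ha := hcont Prod.fst continuous_fst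
  have hb := hcont Prod.snd continuous_snd
  have hd := hcont (fun z => z.1 - z.2) (continuous_fst.sub continuous_snd)
  have hm := hcont (fun z => (z.1 + z.2) / 2) ((continuous_fst.add continuous_snd).div_const _)
  have hT : IsCompact (Metric.sphere (0 : ℝ × ℝ) 1 ∩ {z | ε ≤ |z.1 - z.2| ^ p}) :=
    (isCompact_sphere _ _).inter_right (isClosed_le continuous_const hd)
  obtain ⟨δ, hδ, hgap⟩ := hT.exists_forall_le'
    (f := fun z : ℝ × ℝ => (|z.1| ^ p + |z.2| ^ p) / 2 - |(z.1 + z.2) / 2| ^ p) (a := 0)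
    (((ha.add hb).div_const 2).sub hm).continuousOn (by
      rintro ⟨a, b⟩ ⟨-, h⟩
      refine sub_pos.2 (abs_midpoint_rpow_lt hp ?_)
      intro hab
      simp only at hab
      simp only [hab, Set.mem_ofPred_eq, sub_self, abs_zero, Real.zero_rpow hp0.ne'] at h
      linarith)
  -- On the sphere of the max norm `|a - b| ^ p ≤ 2 ^ p`, while the convexity gap is at least `δ`;
  -- their ratio is the required weight.
  refine ⟨2 ^ p / δ, by positivity, ?_⟩
  have key : ∀ a b : ℝ, ‖((a, b) : ℝ × ℝ)‖ = 1 →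
      |a - b| ^ p + 2 ^ p / δ * |(a + b) / 2| ^ p ≤
        (ε + 2 ^ p / δ / 2) * (|a| ^ p + |b| ^ p) := by
    intro a b hab
    have hmid := abs_midpoint_rpow_le hp a b
    have hK : 0 ≤ 2 ^ p / δ := by positivity
    rw [Prod.norm_mk, Real.norm_eq_abs, Real.norm_eq_abs] at hab
    have ha1 : |a| ≤ 1 := hab ▸ le_max_left _ _
    have hb1 : |b| ≤ 1 := hab ▸ le_max_right _ _
    have ha0 : 0 ≤ |a| ^ p := by positivity
    have hb0 : 0 ≤ |b| ^ p := by positivity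
    have hsum : 1 ≤ |a| ^ p + |b| ^ p := by
      rcases max_choice |a| |b| with h | h <;> rw [h] at hab <;> rw [hab, Real.one_rpow] <;>
        linarith
    by_cases h : ε ≤ |a - b| ^ p
    · have h1 := hgap (a, b) ⟨by simpa [Prod.norm_mk] using hab, h⟩
      simp only at h1
      have h2 : |a - b| ^ p ≤ 2 ^ p :=
        Real.rpow_le_rpow (abs_nonneg _) (by linarith [abs_sub a b]) hp0.le
      have h3 : 2 ^ p ≤ 2 ^ p / δ * ((|a| ^ p + |b| ^ p) / 2 - |(a + b) / 2| ^ p) := by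
        rw [div_mul_eq_mul_div, le_div_iff₀ hδ]
        exact mul_le_mul_of_nonneg_left h1 (by positivity)
      nlinarith
    · nlinarith
  intro a b
  rcases eq_or_ne ((a, b) : ℝ × ℝ) 0 with h0 | h0
  · obtain ⟨rfl, rfl⟩ := Prod.mk_eq_zero.1 h0
    simp [Real.zero_rpow hp0.ne']
  set r : ℝ := ‖((a, b) : ℝ × ℝ)‖ with hr
  have hr0 : 0 < r := norm_pos_iff.2 h0
  have h1 := key (r⁻¹ * a) (r⁻¹ * b) (by
    have : ((r⁻¹ * a, r⁻¹ * b) : ℝ × ℝ) = r⁻¹ • (a, b) := rfl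
    rw [this, norm_smul, ← hr, Real.norm_eq_abs, abs_of_pos (inv_pos.2 hr0),
      inv_mul_cancel₀ hr0.ne'])
  have hs : ∀ x : ℝ, |r⁻¹ * x| ^ p = (r⁻¹) ^ p * |x| ^ p := fun x => by
    rw [abs_mul, abs_of_pos (inv_pos.2 hr0), Real.mul_rpow (inv_pos.2 hr0).le (abs_nonneg _)]
  rw [← mul_sub, ← mul_add, mul_div_assoc, hs, hs, hs, hs] at h1
  have hrp : 0 < (r⁻¹) ^ p := Real.rpow_pos_of_pos (inv_pos.2 hr0) _
  refine le_of_mul_le_mul_left ?_ hrp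
  linarith

/-! The energy -/

section energy

variable {N : ℕ} {B : Set (E N)} {s p : ℝ}

theorem energy_eq_lintegral_prod (B : Set (E N)) (s p : ℝ) (w : E N → ℝ) :
    energy B s p w = ∫⁻ z, ENNReal.ofReal (|w z.1 - w z.2| ^ p / ‖z.1 - z.2‖ ^ ((N : ℝ) + s * p))
      ∂((volume.restrict B).prod (volume.restrict B)) := by
  rw [energy, Measure.prod_restrict, Measure.volume_eq_prod]

theorem energy_congr_on {w w' : E N → ℝ} (h : w =ᵐ[volume.restrict B] w') :
    energy B s p w = energy B s p w' := by
  rw [energy_eq_lintegral_prod, energy_eq_lintegral_prod]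
  refine lintegral_congr_ae ?_
  filter_upwards [Measure.quasiMeasurePreserving_fst.ae h,
    Measure.quasiMeasurePreserving_snd.ae h] with z h1 h2
  rw [h1, h2]

theorem energy_eq_lintegral_lintegral (B : Set (E N)) (s p : ℝ) {w : E N → ℝ}
    (hw : Measurable w) :
    energy B s p w = ∫⁻ x in B, ∫⁻ y in B,
      ENNReal.ofReal (|w x - w y| ^ p / ‖x - y‖ ^ ((N : ℝ) + s * p)) := by
  rw [energy_eq_lintegral_prod, lintegral_prod]
  fun_prop

theorem energy_neg (w : E N → ℝ) : energy B s p (fun x => -w x) = energy B s p w := by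
  unfold energy
  congr 1
  funext z
  rw [← abs_neg]
  congr 4
  ring

theorem energy_sub_comm (v w : E N → ℝ) :
    energy B s p (fun x => v x - w x) = energy B s p (fun x => w x - v x) := by
  rw [← energy_neg]
  simp only [neg_sub]

theorem energy_midpoint_le (hp : 1 < p) {a b : E N → ℝ} (ha : Measurable a) :
    energy B s p (fun x => (a x + b x) / 2) ≤
      ENNReal.ofReal (1 / 2) * (energy B s p a + energy B s p b) := by
  unfold energy
  rw [← lintegral_add_left (by fun_prop), ← lintegral_const_mul' _ _ ENNReal.ofReal_ne_top]
  refine lintegral_mono fun z => ?_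
  simp only
  rw [← ENNReal.ofReal_add (by positivity) (by positivity), ← ENNReal.ofReal_mul (by positivity)]
  refine ENNReal.ofReal_le_ofReal ?_
  rw [← add_div, ← mul_div_assoc]
  refine div_le_div_of_nonneg_right ?_ (by positivity)
  have h := abs_midpoint_rpow_le hp (a z.1 - a z.2) (b z.1 - b z.2)
  rw [show (a z.1 + b z.1) / 2 - (a z.2 + b z.2) / 2
    = (a z.1 - a z.2 + (b z.1 - b z.2)) / 2 by ring]
  linarith

theorem exists_energy_uniform_convexity (hp : 1 < p) {ε : ℝ} (hε : 0 < ε) :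
    ∃ K : ℝ, 0 ≤ K ∧ ∀ a b : E N → ℝ, Measurable a → Measurable b →
      energy B s p (fun x => a x - b x) +
          ENNReal.ofReal K * energy B s p (fun x => (a x + b x) / 2) ≤
        ENNReal.ofReal (ε + K / 2) * (energy B s p a + energy B s p b) := by
  obtain ⟨K, hK, h⟩ := exists_uniform_convexity_rpow hp hε
  refine ⟨K, hK, fun a b ha hb => ?_⟩
  unfold energy
  rw [← lintegral_const_mul' _ _ ENNReal.ofReal_ne_top, ← lintegral_add_left (by fun_prop),
    ← lintegral_add_left (by fun_prop), ← lintegral_const_mul' _ _ ENNReal.ofReal_ne_top]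
  refine lintegral_mono fun z => ?_
  simp only
  rw [← ENNReal.ofReal_add (by positivity) (by positivity), ← ENNReal.ofReal_mul hK,
    ← ENNReal.ofReal_mul (by positivity), ← ENNReal.ofReal_add (by positivity) (by positivity)]
  refine ENNReal.ofReal_le_ofReal ?_
  rw [← add_div, ← mul_div_assoc, ← mul_div_assoc, ← add_div]
  refine div_le_div_of_nonneg_right ?_ (by positivity)
  have h := h (a z.1 - a z.2) (b z.1 - b z.2)
  rw [show (a z.1 + b z.1) / 2 - (a z.2 + b z.2) / 2
      = (a z.1 - a z.2 + (b z.1 - b z.2)) / 2 by ring,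
    show a z.1 - b z.1 - (a z.2 - b z.2) = a z.1 - a z.2 - (b z.1 - b z.2) by ring]
  exact h

/-- Minkowski's inequality for the difference quotients. The constant 1, in contrast with the `2 ^
(p - 1)` of `energy_add_le`, is what makes the energy of an approximating test function nearly that
of its target. -/
theorem energy_rpow_add_le (hp : 1 < p) {a b : E N → ℝ} (ha : Measurable a) (hb : Measurable b) :
    energy B s p (fun x => a x + b x) ^ (1 / p) ≤
      energy B s p a ^ (1 / p) + energy B s p b ^ (1 / p) := by
  have hp0 : 0 < p := by linarith
  let q : (E N → ℝ) → E N × E N → ℝ≥0∞ := fun w z =>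
    ENNReal.ofReal (|w z.1 - w z.2| / (‖z.1 - z.2‖ ^ ((N : ℝ) + s * p)) ^ (1 / p))
  have hq : ∀ w, energy B s p w = ∫⁻ z in B ×ˢ B, q w z ^ p := fun w => by
    refine lintegral_congr fun z => ?_
    rw [ENNReal.ofReal_rpow_of_nonneg (by positivity) hp0.le,
      Real.div_rpow (abs_nonneg _) (by positivity), ← Real.rpow_mul (by positivity) (1 / p) p,
      one_div_mul_cancel hp0.ne', Real.rpow_one]
  have hm : ∀ w, Measurable w → Measurable (q w) := fun w hw => by fun_prop
  rw [hq, hq, hq]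
  refine le_trans ?_ (ENNReal.lintegral_Lp_add_le (hm a ha).aemeasurable
    (hm b hb).aemeasurable hp.le)
  refine ENNReal.rpow_le_rpow (lintegral_mono fun z => ENNReal.rpow_le_rpow ?_ hp0.le)
    (by positivity)
  simp only [q, Pi.add_apply]
  rw [← ENNReal.ofReal_add (by positivity) (by positivity), ← add_div]
  refine ENNReal.ofReal_le_ofReal (div_le_div_of_nonneg_right ?_ (by positivity))
  rw [show a z.1 + b z.1 - (a z.2 + b z.2) = (a z.1 - a z.2) + (b z.1 - b z.2) by ring]
  exact abs_add_le _ _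

end energy

/-! ### The ball `B` against `Ω`, and the Poincaré inequality -/

section geometry

variable {N : ℕ} {Ω : Opens (E N)}

theorem diam_pos_of_nonempty (hN : 1 ≤ N) (hne : (Ω : Set (E N)).Nonempty)
    (hbdd : Bornology.IsBounded (Ω : Set (E N))) : 0 < Metric.diam (Ω : Set (E N)) := by
  have : Nonempty (Fin N) := ⟨⟨0, hN⟩⟩
  obtain ⟨x, hx⟩ := hne
  exact Metric.diam_pos (infinite_of_mem_nhds x (Ω.isOpen.mem_nhds hx)).nontrivial hbdd

/-- If the difference were null, the open ball would lie in the closure of `Ω`, which has diameter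
`R`; but the ball contains two antipodal points at distance `2ρ > R`. -/
theorem volume_relBall_diff_pos (hN : 1 ≤ N) (hne : (Ω : Set (E N)).Nonempty)
    (hbdd : Bornology.IsBounded (Ω : Set (E N))) (c : E N) {t : ℝ} (ht : 1 < t) :
    0 < volume (relBall Ω c t \ Ω) := by
  have : Nonempty (Fin N) := ⟨⟨0, hN⟩⟩
  have hR := diam_pos_of_nonempty hN hne hbdd
  set R := Metric.diam (Ω : Set (E N)) with hRdef
  rw [pos_iff_ne_zero]
  intro h0
  have hsub : relBall Ω c t ⊆ closure (Ω : Set (E N)) := by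
    intro x hx
    by_contra hxc
    have hpos : 0 < volume (relBall Ω c t ∩ (closure (Ω : Set (E N)))ᶜ) :=
      (Metric.isOpen_ball.inter isClosed_closure.isOpen_compl).measure_pos _ ⟨x, hx, hxc⟩
    have hincl : relBall Ω c t ∩ (closure (Ω : Set (E N)))ᶜ ⊆ relBall Ω c t \ Ω :=
      fun y hy => ⟨hy.1, fun h => hy.2 (subset_closure h)⟩
    exact hpos.ne' (measure_mono_null hincl h0)
  obtain ⟨e, he⟩ := exists_norm_eq (E N) zero_le_one
  have hlt : R / 2 < t * R / 2 := by nlinarith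
  obtain ⟨ρ, h1, h2⟩ := exists_between hlt
  have hρ : 0 < ρ := by linarith
  have hmem : ∀ a : ℝ, |a| = ρ → c + a • e ∈ relBall Ω c t := fun a ha => by
    rw [relBall, Metric.mem_ball, dist_eq_norm, add_sub_cancel_left, norm_smul, he, mul_one,
      Real.norm_eq_abs, ha]
    exact h2
  have hd := Metric.dist_le_diam_of_mem hbdd.closure (hsub (hmem ρ (abs_of_pos hρ)))
    (hsub (hmem (-ρ) (by rw [abs_neg, abs_of_pos hρ])))
  rw [Metric.diam_closure, dist_eq_norm, add_sub_add_left_eq_sub, ← sub_smul, norm_smul, he,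
    mul_one, Real.norm_eq_abs, sub_neg_eq_add, abs_of_pos (by linarith)] at hd
  linarith

theorem norm_sub_le_of_mem_relBall {c x y : E N} {t : ℝ} (hx : x ∈ relBall Ω c t)
    (hy : y ∈ relBall Ω c t) : ‖x - y‖ ≤ t * Metric.diam (Ω : Set (E N)) := by
  rw [← dist_eq_norm]
  have h1 := Metric.mem_ball.1 hx
  have h2 := Metric.mem_ball'.1 hy
  linarith [dist_triangle x c y]

theorem abs_rpow_le_mul_div_rpow {p q d D : ℝ} (hp : 0 < p) (hq : 0 ≤ q) (a : ℝ)
    (hd : 0 ≤ d) (ha : d = 0 → a = 0) (hD : d ≤ D) :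
    |a| ^ p ≤ D ^ q * (|a| ^ p / d ^ q) := by
  rcases hd.eq_or_lt with h0 | hpos
  · rw [ha h0.symm]
    simp [Real.zero_rpow hp.ne']
  · rw [mul_div_assoc', le_div_iff₀ (by positivity), mul_comm]
    exact mul_le_mul_of_nonneg_right (Real.rpow_le_rpow hd hD hq) (by positivity)

/-- For `y` in `B \ Ω` one has `w y = 0`, so averaging `|w x - w y| ^ p` over this set of positive
measure returns `|w x| ^ p`, while the kernel is bounded below on `B × B`. -/
theorem exists_poincare_const (hN : 1 ≤ N) (hne : (Ω : Set (E N)).Nonempty)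
    (hbdd : Bornology.IsBounded (Ω : Set (E N))) (c : E N) {t : ℝ} (ht : 1 < t) {p s : ℝ}
    (hp : 1 < p) (hs : 0 < s) :
    ∃ C : ℝ, 0 ≤ C ∧ ∀ w : E N → ℝ, Measurable w → (∀ x ∉ Ω, w x = 0) →
      ∫⁻ x in relBall Ω c t, ENNReal.ofReal (|w x| ^ p) ≤
        ENNReal.ofReal C * energy (relBall Ω c t) s p w := by
  set B := relBall Ω c t with hB
  set V := volume (B \ Ω) with hV
  have hV0 : V ≠ 0 := (volume_relBall_diff_pos hN hne hbdd c ht).ne'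
  have hVt : V ≠ ∞ := (measure_mono Set.sdiff_subset).trans_lt measure_ball_lt_top |>.ne
  set q : ℝ := (N : ℝ) + s * p with hq
  have hq0 : 0 ≤ q := by positivity
  set D : ℝ := (t * Metric.diam (Ω : Set (E N))) ^ q with hD
  have hD0 : 0 ≤ D := Real.rpow_nonneg (mul_nonneg (by linarith) Metric.diam_nonneg) _
  refine ⟨V.toReal⁻¹ * D, by positivity, fun w hw hw0 => ?_⟩
  have hBm : MeasurableSet B := Metric.isOpen_ball.measurableSet
  rw [energy_eq_lintegral_lintegral _ _ _ hw, ← lintegral_const_mul' _ _ ENNReal.ofReal_ne_top]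
  refine setLIntegral_mono' hBm fun x hx => ?_
  have key : ENNReal.ofReal (|w x| ^ p) * V ≤ ENNReal.ofReal D *
      ∫⁻ y in B, ENNReal.ofReal (|w x - w y| ^ p / ‖x - y‖ ^ q) := by
    calc ENNReal.ofReal (|w x| ^ p) * V
        = ∫⁻ _ in B \ Ω, ENNReal.ofReal (|w x| ^ p) := by rw [setLIntegral_const]
      _ ≤ ∫⁻ y in B \ Ω, ENNReal.ofReal D *
            ENNReal.ofReal (|w x - w y| ^ p / ‖x - y‖ ^ q) := by
          refine setLIntegral_mono' (hBm.diff Ω.isOpen.measurableSet) fun y hy => ?_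
          rw [← ENNReal.ofReal_mul hD0]
          refine ENNReal.ofReal_le_ofReal ?_
          have := abs_rpow_le_mul_div_rpow (p := p) (q := q) (by linarith) hq0 (w x - w y)
            (norm_nonneg (x - y)) (fun h => by rw [sub_eq_zero.1 (norm_eq_zero.1 h), sub_self])
            (norm_sub_le_of_mem_relBall hx hy.1)
          rwa [hw0 y hy.2, sub_zero] at this ⊢
      _ ≤ _ := by
          rw [lintegral_const_mul' _ _ ENNReal.ofReal_ne_top]
          gcongr
          exact Set.sdiff_subset
  rw [ENNReal.ofReal_mul (by positivity), ENNReal.ofReal_inv_of_pos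
    (ENNReal.toReal_pos hV0 hVt), ENNReal.ofReal_toReal hVt, mul_assoc, mul_comm V⁻¹,
    ← div_eq_mul_inv, ENNReal.le_div_iff_mul_le (Or.inl hV0) (Or.inl hVt)]
  exact key

end geometry

/-! ### Control of the `L^p` norm by finitely many averages -/

section averages

variable {N : ℕ}

theorem lintegral_rpow_le_measure_mul {α : Type*} [MeasurableSpace α] {μ : Measure α} {p : ℝ}
    (hp : 1 < p) {g : α → ℝ≥0∞} (hg : Measurable g) :
    (∫⁻ x, g x ∂μ) ^ p ≤ μ Set.univ ^ (p - 1) * ∫⁻ x, g x ^ p ∂μ := by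
  have hp0 : 0 < p := by linarith
  have hpq := Real.HolderConjugate.conjExponent hp
  have h := ENNReal.lintegral_mul_le_Lp_mul_Lq μ hpq hg.aemeasurable
    (measurable_const (a := (1 : ℝ≥0∞))).aemeasurable
  simp only [Pi.mul_apply, mul_one, ENNReal.one_rpow, lintegral_one] at h
  refine (ENNReal.rpow_le_rpow h hp0.le).trans (le_of_eq ?_)
  rw [ENNReal.mul_rpow_of_nonneg _ _ hp0.le, ← ENNReal.rpow_mul, ← ENNReal.rpow_mul,
    one_div_mul_cancel hp0.ne', ENNReal.rpow_one, mul_comm]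
  congr 2
  rw [Real.conjExponent]
  field_simp

/-- The number `a` is the mean of `a - w` plus the mean of `w` over `C`; Jensen's inequality,
through Hölder, moves the power inside the first mean. -/
theorem ofReal_rpow_le_of_average {p : ℝ} (hp : 1 < p) {w : E N → ℝ} (hw : Measurable w)
    {C : Set (E N)} (hC0 : volume C ≠ 0) (hCt : volume C ≠ ∞) (hwC : IntegrableOn w C)
    {η : ℝ} (hη : |∫ y in C, w y| ≤ η) (a : ℝ) :
    ENNReal.ofReal (|a| ^ p) ≤ 2 ^ (p - 1) *
      ((volume C)⁻¹ * (∫⁻ y in C, ENNReal.ofReal (|a - w y| ^ p)) +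
        ((volume C)⁻¹ * ENNReal.ofReal η) ^ p) := by
  have hp0 : 0 < p := by linarith
  set m := volume C with hm
  set g : E N → ℝ≥0∞ := fun y => ENNReal.ofReal |a - w y| with hg
  have hfin : IsFiniteMeasure (volume.restrict C) :=
    ⟨by rwa [Measure.restrict_apply_univ, lt_top_iff_ne_top]⟩
  have h1 : ENNReal.ofReal |a| * m ≤ (∫⁻ y in C, g y) + ENNReal.ofReal η := by
    have hint : IntegrableOn (fun y => a - w y) C := (integrable_const a).sub hwC
    have h2 : m.toReal * a = (∫ y in C, (a - w y)) + ∫ y in C, w y := by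
      rw [integral_sub (integrable_const a) hwC, setIntegral_const, sub_add_cancel]
      simp [Measure.real, hm]
    have h3 : ENNReal.ofReal |a| * m = ENNReal.ofReal |m.toReal * a| := by
      rw [abs_mul, abs_of_nonneg ENNReal.toReal_nonneg, ENNReal.ofReal_mul ENNReal.toReal_nonneg,
        ENNReal.ofReal_toReal hCt, mul_comm]
    rw [h3, h2]
    refine (ENNReal.ofReal_le_ofReal (abs_add_le _ _)).trans ?_
    rw [ENNReal.ofReal_add (abs_nonneg _) (abs_nonneg _)]
    refine add_le_add ?_ (ENNReal.ofReal_le_ofReal hη)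
    have := enorm_integral_le_lintegral_enorm (μ := volume.restrict C) (fun y => a - w y)
    simpa only [Real.enorm_eq_ofReal_abs] using this
  have h2 : ENNReal.ofReal |a| ≤ m⁻¹ * (∫⁻ y in C, g y) + m⁻¹ * ENNReal.ofReal η := by
    rw [← mul_add, mul_comm, ← div_eq_mul_inv, ENNReal.le_div_iff_mul_le (Or.inl hC0) (Or.inl hCt)]
    exact h1
  have h3 : (m⁻¹ * ∫⁻ y in C, g y) ^ p ≤ m⁻¹ * ∫⁻ y in C, g y ^ p := by
    have hgm : Measurable g := by fun_prop
    rw [ENNReal.mul_rpow_of_nonneg _ _ hp0.le]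
    refine (mul_le_mul_right (lintegral_rpow_le_measure_mul hp hgm) _).trans (le_of_eq ?_)
    rw [Measure.restrict_apply_univ, ← hm, ← mul_assoc, ENNReal.inv_rpow, ← ENNReal.rpow_neg,
      ← ENNReal.rpow_add _ _ hC0 hCt, ← ENNReal.rpow_neg_one]
    congr 2
    ring
  rw [← ENNReal.ofReal_rpow_of_nonneg (abs_nonneg _) hp0.le]
  refine (ENNReal.rpow_le_rpow h2 hp0.le).trans ((ENNReal.rpow_add_le_mul_rpow_add_rpow _ _
    hp.le).trans ?_)
  gcongr
  refine h3.trans (le_of_eq ?_)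
  congr 1
  refine lintegral_congr fun y => ?_
  rw [hg, ENNReal.ofReal_rpow_of_nonneg (abs_nonneg _) hp0.le]

/-- Centers are taken in the ball of radius `r - h` so that the small balls stay inside. Contracting
`x` by the factor `1 - h / r` moves it by at most `h`, and reaching the net and then `y` costs at
most `h` each. -/
theorem exists_finset_net_ball (c : E N) {r h : ℝ} (hh : 0 < h) (hr : h ≤ r) :
    ∃ Z : Finset (E N), (∀ z ∈ Z, Metric.ball z h ⊆ Metric.ball c r) ∧
      ∀ x ∈ Metric.ball c r, ∃ z ∈ Z, ∀ y ∈ Metric.ball z h, ‖x - y‖ ≤ 3 * h := by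
  obtain ⟨Z, hZ, hfin, hcov⟩ := (isCompact_closedBall c (r - h)).finite_cover_balls hh
  refine ⟨hfin.toFinset, fun z hz => ?_, fun x hx => ?_⟩
  · have := Metric.mem_closedBall.1 (hZ (hfin.mem_toFinset.1 hz))
    exact Metric.ball_subset_ball' (by linarith)
  · have hr0 : 0 < r := hh.trans_le hr
    have hx' : ‖x - c‖ < r := by rwa [← dist_eq_norm]
    have hmem : c + (1 - h / r) • (x - c) ∈ Metric.closedBall c (r - h) := by
      have h1 : 0 ≤ 1 - h / r := by rw [sub_nonneg, div_le_one hr0]; exact hr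
      rw [Metric.mem_closedBall, dist_eq_norm, add_sub_cancel_left, norm_smul, Real.norm_eq_abs,
        abs_of_nonneg h1]
      calc (1 - h / r) * ‖x - c‖ ≤ (1 - h / r) * r := mul_le_mul_of_nonneg_left hx'.le h1
        _ = r - h := by field_simp
    obtain ⟨z, hz, hxz⟩ := Set.mem_iUnion₂.1 (hcov hmem)
    refine ⟨z, hfin.mem_toFinset.2 hz, fun y hy => ?_⟩
    have h2 : dist x (c + (1 - h / r) • (x - c)) ≤ h := by
      rw [dist_eq_norm, show x - (c + (1 - h / r) • (x - c)) = (h / r) • (x - c) by module,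
        norm_smul, Real.norm_eq_abs, abs_of_pos (by positivity)]
      calc h / r * ‖x - c‖ ≤ h / r * r := by gcongr
        _ = h := by field_simp
    rw [← dist_eq_norm]
    have h3 := Metric.mem_ball.1 hxz
    have h4 := Metric.mem_ball'.1 hy
    linarith [dist_triangle4 x (c + (1 - h / r) • (x - c)) z y]

end averages

section averages

variable {N : ℕ}

theorem lintegral_rpow_le_of_averages {c : E N} {r h p s : ℝ} (hh : 0 < h) (hp : 1 < p)
    (hs : 0 < s) {Z : Finset (E N)}
    (hZ : ∀ z ∈ Z, Metric.ball z h ⊆ Metric.ball c r)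
    (hZ' : ∀ x ∈ Metric.ball c r, ∃ z ∈ Z, ∀ y ∈ Metric.ball z h, ‖x - y‖ ≤ 3 * h)
    {w : E N → ℝ} (hw : Measurable w) (hint : IntegrableOn w (Metric.ball c r)) {η : ℝ}
    (hη : ∀ z ∈ Z, |∫ y in Metric.ball z h, w y| ≤ η) :
    ∫⁻ x in Metric.ball c r, ENNReal.ofReal (|w x| ^ p) ≤ 2 ^ (p - 1) *
      ((volume (Metric.ball (0 : E N) h))⁻¹ * ENNReal.ofReal ((3 * h) ^ ((N : ℝ) + s * p)) *
          energy (Metric.ball c r) s p w +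
        ((volume (Metric.ball (0 : E N) h))⁻¹ * ENNReal.ofReal η) ^ p *
          volume (Metric.ball c r)) := by
  set m := volume (Metric.ball (0 : E N) h) with hm
  set q : ℝ := (N : ℝ) + s * p with hq
  have hq0 : 0 ≤ q := by positivity
  have h2 : (2 : ℝ≥0∞) ^ (p - 1) ≠ ∞ := ENNReal.rpow_ne_top_of_nonneg (by linarith) (by simp)
  have hm0 : m ≠ 0 := (Metric.measure_ball_pos _ _ hh).ne'
  have hmt : m ≠ ∞ := measure_ball_lt_top.ne
  have hvol : ∀ z : E N, volume (Metric.ball z h) = m := fun z => Measure.addHaar_ball_center _ z h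
  calc ∫⁻ x in Metric.ball c r, ENNReal.ofReal (|w x| ^ p)
      ≤ ∫⁻ x in Metric.ball c r, 2 ^ (p - 1) *
          (m⁻¹ * (ENNReal.ofReal ((3 * h) ^ q) * ∫⁻ y in Metric.ball c r,
            ENNReal.ofReal (|w x - w y| ^ p / ‖x - y‖ ^ q)) + (m⁻¹ * ENNReal.ofReal η) ^ p) := by
        refine setLIntegral_mono' Metric.isOpen_ball.measurableSet fun x hx => ?_
        obtain ⟨z, hz, hzx⟩ := hZ' x hx
        have h1 := ofReal_rpow_le_of_average hp hw (C := Metric.ball z h) (by rwa [hvol])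
          (by rwa [hvol]) (hint.mono_set (hZ z hz)) (hη z hz) (w x)
        rw [hvol] at h1
        refine h1.trans ?_
        gcongr
        rw [← lintegral_const_mul' _ _ ENNReal.ofReal_ne_top]
        refine le_trans ?_ (lintegral_mono_set (hZ z hz))
        refine setLIntegral_mono' Metric.isOpen_ball.measurableSet fun y hy => ?_
        rw [← ENNReal.ofReal_mul (by positivity)]
        exact ENNReal.ofReal_le_ofReal (abs_rpow_le_mul_div_rpow (by linarith) hq0 _
          (norm_nonneg _) (fun h => by rw [sub_eq_zero.1 (norm_eq_zero.1 h), sub_self])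
          (hzx y hy))
    _ = _ := by
        rw [lintegral_const_mul' _ _ h2, lintegral_add_right _ measurable_const,
          lintegral_const_mul' _ _ (ENNReal.inv_ne_top.2 hm0),
          lintegral_const_mul' _ _ ENNReal.ofReal_ne_top, setLIntegral_const,
          ← energy_eq_lintegral_lintegral _ _ _ hw, mul_assoc m⁻¹]

/-- The quantitative core of compactness: at scale `h` the energy contributes a multiple of `h ^ (s
p)`, which is small because `s p > 0`. The scale is chosen first; the tolerance `η` on the averages
may then depend on it. -/
theorem exists_finite_averages (hN : 1 ≤ N) (c : E N) {r p s : ℝ} (hr : 0 < r) (hp : 1 < p)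
    (hs : 0 < s) (M : ℝ) {δ : ℝ} (hδ : 0 < δ) :
    ∃ (Z : Finset (E N)) (h η : ℝ), 0 < h ∧ 0 < η ∧
      (∀ z ∈ Z, Metric.ball z h ⊆ Metric.ball c r) ∧
      ∀ w : E N → ℝ, Measurable w → IntegrableOn w (Metric.ball c r) →
        energy (Metric.ball c r) s p w ≤ ENNReal.ofReal M →
        (∀ z ∈ Z, |∫ y in Metric.ball z h, w y| ≤ η) →
        ∫⁻ x in Metric.ball c r, ENNReal.ofReal (|w x| ^ p) ≤ ENNReal.ofReal δ := by
  have hp0 : 0 < p := by linarith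
  have : Nonempty (Fin N) := ⟨⟨0, hN⟩⟩
  set ω := volume (Metric.ball (0 : E N) 1) with hω
  have hω0 : ω ≠ 0 := (Metric.measure_ball_pos _ _ one_pos).ne'
  have hωt : ω ≠ ∞ := measure_ball_lt_top.ne
  have h2 : (2 : ℝ≥0∞) ^ (p - 1) ≠ ∞ := ENNReal.rpow_ne_top_of_nonneg (by linarith) (by simp)
  set δ' : ℝ≥0∞ := ENNReal.ofReal (δ / 2) with hδ'
  have hδ'0 : 0 < δ' := ENNReal.ofReal_pos.2 (by linarith)
  have hvol : ∀ h : ℝ, 0 < h →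
      volume (Metric.ball (0 : E N) h) = ENNReal.ofReal (h ^ (N : ℝ)) * ω :=
    fun h hh => by
      rw [Measure.addHaar_ball _ _ hh.le, finrank_euclideanSpace_fin, Real.rpow_natCast]
  have hlim1 : Tendsto (fun h : ℝ => (2 : ℝ≥0∞) ^ (p - 1) *
      (ω⁻¹ * ENNReal.ofReal (3 ^ ((N : ℝ) + s * p)) * ENNReal.ofReal (h ^ (s * p)) *
        ENNReal.ofReal M)) (𝓝 0) (𝓝 0) := by
    have h0 : Tendsto (fun h : ℝ => ENNReal.ofReal (h ^ (s * p))) (𝓝 0) (𝓝 0) := by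
      have : Tendsto (fun h : ℝ => h ^ (s * p)) (𝓝 0) (𝓝 (0 ^ (s * p))) :=
        (Real.continuous_rpow_const (by positivity)).tendsto 0
      rw [Real.zero_rpow (by positivity)] at this
      simpa using ENNReal.tendsto_ofReal this
    have h1 := ENNReal.Tendsto.const_mul (a := (2 : ℝ≥0∞) ^ (p - 1))
      (ENNReal.Tendsto.mul_const (b := ENNReal.ofReal M) (ENNReal.Tendsto.const_mul
        (a := ω⁻¹ * ENNReal.ofReal (3 ^ ((N : ℝ) + s * p))) h0
        (Or.inr (ENNReal.mul_ne_top (ENNReal.inv_ne_top.2 hω0) ENNReal.ofReal_ne_top)))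
        (Or.inr ENNReal.ofReal_ne_top)) (Or.inr h2)
    simpa using h1
  obtain ⟨h, ⟨hlt1, hhr⟩, hh : 0 < h⟩ := (((hlim1.eventually_lt_const hδ'0).and
    (eventually_le_nhds hr)).filter_mono (nhdsWithin_le_nhds (s := Set.Ioi 0)) |>.and
    self_mem_nhdsWithin).exists
  obtain ⟨Z, hZ, hZ'⟩ := exists_finset_net_ball c hh hhr
  set m := volume (Metric.ball (0 : E N) h) with hm
  have hm0 : m ≠ 0 := (Metric.measure_ball_pos _ _ hh).ne'
  have hlim2 : Tendsto (fun η : ℝ => (2 : ℝ≥0∞) ^ (p - 1) *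
      ((m⁻¹ * ENNReal.ofReal η) ^ p * volume (Metric.ball c r))) (𝓝 0) (𝓝 0) := by
    have h0 : Tendsto (fun η : ℝ => m⁻¹ * ENNReal.ofReal η) (𝓝 0) (𝓝 0) := by
      have := ENNReal.Tendsto.const_mul (a := m⁻¹) (ENNReal.tendsto_ofReal
        (tendsto_id (α := ℝ) (x := 𝓝 0))) (Or.inr (ENNReal.inv_ne_top.2 hm0))
      simpa using this
    have h1 := (ENNReal.continuous_rpow_const (y := p)).tendsto 0 |>.comp h0
    rw [ENNReal.zero_rpow_of_pos hp0] at h1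
    have h3 := ENNReal.Tendsto.const_mul (a := (2 : ℝ≥0∞) ^ (p - 1))
      (ENNReal.Tendsto.mul_const h1 (b := volume (Metric.ball c r))
        (Or.inr measure_ball_lt_top.ne)) (Or.inr h2)
    simpa using h3
  obtain ⟨η, hlt2, hη : 0 < η⟩ := ((hlim2.eventually_lt_const hδ'0).filter_mono
    (nhdsWithin_le_nhds (s := Set.Ioi 0)) |>.and self_mem_nhdsWithin).exists
  refine ⟨Z, h, η, hh, hη, hZ, fun w hw hint hM hav => ?_⟩
  refine (lintegral_rpow_le_of_averages hh hp hs hZ hZ' hw hint hav).trans ?_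
  rw [show δ = δ / 2 + δ / 2 by ring, ENNReal.ofReal_add (by linarith) (by linarith), mul_add]
  refine add_le_add (le_trans ?_ hlt1.le) hlt2.le
  -- The volume of the small ball scales like `h ^ N` and cancels that part of `(3 h) ^ (N + s p)`.
  have hfac : m⁻¹ * ENNReal.ofReal ((3 * h) ^ ((N : ℝ) + s * p)) =
      ω⁻¹ * ENNReal.ofReal (3 ^ ((N : ℝ) + s * p)) * ENNReal.ofReal (h ^ (s * p)) := by
    have hhN : ENNReal.ofReal (h ^ (N : ℝ)) ≠ 0 := (ENNReal.ofReal_pos.2 (by positivity)).ne'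
    rw [hm, hvol h hh, Real.mul_rpow (by norm_num) hh.le, Real.rpow_add hh,
      ENNReal.ofReal_mul (by positivity), ENNReal.ofReal_mul (by positivity),
      ENNReal.mul_inv (Or.inl hhN) (Or.inl ENNReal.ofReal_ne_top)]
    calc _ = (ENNReal.ofReal (h ^ (N : ℝ)))⁻¹ * ENNReal.ofReal (h ^ (N : ℝ)) *
        (ω⁻¹ * ENNReal.ofReal (3 ^ ((N : ℝ) + s * p)) * ENNReal.ofReal (h ^ (s * p))) := by ring
      _ = _ := by rw [ENNReal.inv_mul_cancel hhN ENNReal.ofReal_ne_top, one_mul]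
  rw [hfac]
  gcongr

end averages

/-! ### Total boundedness of energy balls in `L^p` -/

section Lp

variable {N : ℕ} {Ω : Opens (E N)} {p : ℝ}

theorem zeroExt_toLp {w : E N → ℝ}
    (hw : MemLp w (ENNReal.ofReal p) (volume.restrict (Ω : Set (E N)))) :
    zeroExt (hw.toLp w : LpOn Ω p) =ᵐ[volume] (Ω : Set (E N)).indicator w := by
  filter_upwards [ae_imp_of_ae_restrict hw.coeFn_toLp] with x hx
  by_cases h : x ∈ (Ω : Set (E N))
  · simp only [zeroExt, Set.indicator_of_mem h, hx h]
  · simp only [zeroExt, Set.indicator_of_notMem h]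

theorem zeroExt_of_notMem (u : LpOn Ω p) {x : E N} (hx : x ∉ Ω) : zeroExt u x = 0 :=
  Set.indicator_of_notMem hx _

theorem zeroExt_neg (u : LpOn Ω p) : zeroExt (-u) =ᵐ[volume] fun x => -zeroExt u x := by
  filter_upwards [zeroExt_smul (-1) u] with x hx
  rw [← neg_one_smul ℝ u, hx, neg_one_mul]

theorem zeroExt_sub (u v : LpOn Ω p) :
    zeroExt (u - v) =ᵐ[volume] fun x => zeroExt u x - zeroExt v x := by
  filter_upwards [zeroExt_add u (-v), zeroExt_neg v] with x h1 h2
  rw [sub_eq_add_neg, h1, h2, sub_eq_add_neg]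

theorem zeroExt_midpoint (u v : LpOn Ω p) :
    zeroExt ((1 / 2 : ℝ) • (u + v)) =ᵐ[volume] fun x => (zeroExt u x + zeroExt v x) / 2 := by
  filter_upwards [zeroExt_smul (1 / 2 : ℝ) (u + v), zeroExt_add u v] with x h1 h2
  rw [h1, h2]
  ring

theorem ofReal_norm_rpow (hp : 1 < p) (u : LpOn Ω p) :
    ENNReal.ofReal (‖u‖ ^ p) = ∫⁻ x, ENNReal.ofReal (|zeroExt u x| ^ p) := by
  have hp0 : 0 < p := by linarith
  have hF : Fact (1 < p) := ⟨hp⟩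
  have h1 : ∫⁻ x, ENNReal.ofReal (|zeroExt u x| ^ p) =
      ∫⁻ x in (Ω : Set (E N)), ENNReal.ofReal (|u x| ^ p) := by
    rw [← lintegral_indicator Ω.isOpen.measurableSet]
    refine lintegral_congr fun x => ?_
    by_cases h : x ∈ (Ω : Set (E N))
    · simp only [zeroExt, Set.indicator_of_mem h]
    · simp [zeroExt, Set.indicator_of_notMem h, Real.zero_rpow hp0.ne']
  rw [h1, ← ENNReal.ofReal_rpow_of_nonneg (norm_nonneg u) hp0.le, Lp.norm_def,
    ENNReal.ofReal_toReal (Lp.eLpNorm_ne_top u),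
    eLpNorm_eq_lintegral_rpow_enorm_toReal (by simpa using hp0) ENNReal.ofReal_ne_top,
    ENNReal.toReal_ofReal hp0.le, ← ENNReal.rpow_mul, one_div_mul_cancel hp0.ne', ENNReal.rpow_one]
  refine lintegral_congr fun x => ?_
  rw [Real.enorm_eq_ofReal_abs, ENNReal.ofReal_rpow_of_nonneg (abs_nonneg _) hp0.le]

/-- The product of `u` with the characteristic function of `B`. -/
noncomputable def cutoff {B : Set (E N)} (hB : MeasurableSet B) (u : LpOn Ω p) : LpOn Ω p :=
  ((Lp.memLp u).indicator hB).toLp _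

theorem zeroExt_cutoff {B : Set (E N)} (hB : MeasurableSet B) (u : LpOn Ω p) :
    zeroExt (cutoff hB u) =ᵐ[volume] B.indicator (zeroExt u) := by
  filter_upwards [zeroExt_toLp ((Lp.memLp u).indicator hB)] with x hx
  rw [cutoff, hx, zeroExt, Set.indicator_indicator, Set.indicator_indicator, Set.inter_comm]

theorem zeroExt_cutoff_restrict {B : Set (E N)} (hB : MeasurableSet B) (u : LpOn Ω p) :
    zeroExt (cutoff hB u) =ᵐ[volume.restrict B] zeroExt u := by
  filter_upwards [ae_restrict_of_ae (zeroExt_cutoff hB u), ae_restrict_mem hB] with x hx h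
  rw [hx, Set.indicator_of_mem h]

theorem ofReal_norm_rpow_of_ae_eq_zero (hp : 1 < p) {B : Set (E N)} (hB : MeasurableSet B)
    {u : LpOn Ω p} (hu : ∀ᵐ x, x ∉ B → zeroExt u x = 0) :
    ENNReal.ofReal (‖u‖ ^ p) = ∫⁻ x in B, ENNReal.ofReal (|zeroExt u x| ^ p) := by
  rw [ofReal_norm_rpow hp, ← lintegral_indicator hB]
  refine lintegral_congr_ae ?_
  filter_upwards [hu] with x hx
  by_cases h : x ∈ B
  · rw [Set.indicator_of_mem h]
  · rw [Set.indicator_of_notMem h, hx h, abs_zero, Real.zero_rpow (by linarith),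
      ENNReal.ofReal_zero]

theorem lintegral_enorm_le_add {B : Set (E N)} (hp : 1 < p) (w : E N → ℝ) :
    ∫⁻ x in B, ‖w x‖ₑ ≤ volume B + ∫⁻ x in B, ENNReal.ofReal (|w x| ^ p) := by
  rw [← setLIntegral_one, ← lintegral_add_left measurable_const]
  refine lintegral_mono fun x => ?_
  rw [Real.enorm_eq_ofReal_abs, ← ENNReal.ofReal_one, ← ENNReal.ofReal_add one_pos.le
    (by positivity)]
  refine ENNReal.ofReal_le_ofReal ?_
  rcases le_total |w x| 1 with h | h
  · have : 0 ≤ |w x| ^ p := by positivity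
    linarith
  · linarith [Real.self_le_rpow_of_one_le h hp.le]

/-- Each function is encoded by the rounded integrals over the finitely many balls of
`exists_finite_averages`. Poincaré bounds these integrals, so there are finitely many codes, and two
functions with the same code are close. Vanishing outside `B` makes the integral over `B` the full
norm. -/
theorem totallyBounded_energy_le (hN : 1 ≤ N) (hne : (Ω : Set (E N)).Nonempty)
    (hbdd : Bornology.IsBounded (Ω : Set (E N))) (c : E N) {t : ℝ} (ht : 1 < t) {s : ℝ}
    [hp : Fact (1 < p)] (hs : 0 < s) (M : ℝ) :
    TotallyBounded {u : LpOn Ω p | (∀ᵐ x, x ∉ relBall Ω c t → zeroExt u x = 0) ∧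
      energy (relBall Ω c t) s p (zeroExt u) ≤ ENNReal.ofReal M} := by
  have hp0 : 0 < p := by linarith [hp.out]
  set B := relBall Ω c t with hB
  have hBm : MeasurableSet B := Metric.isOpen_ball.measurableSet
  have hBt : volume B ≠ ∞ := measure_ball_lt_top.ne
  have hr : 0 < t * Metric.diam (Ω : Set (E N)) / 2 := by
    have := diam_pos_of_nonempty hN hne hbdd
    positivity
  obtain ⟨C, hC, hpoin⟩ := exists_poincare_const hN hne hbdd c ht hp.out hs
  set S := {u : LpOn Ω p | (∀ᵐ x, x ∉ B → zeroExt u x = 0) ∧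
    energy B s p (zeroExt u) ≤ ENNReal.ofReal M} with hS
  set A₀ : ℝ≥0∞ := volume B + ENNReal.ofReal C * ENNReal.ofReal M with hA₀
  have hA₀t : A₀ ≠ ∞ := ENNReal.add_ne_top.2
    ⟨hBt, ENNReal.mul_ne_top ENNReal.ofReal_ne_top ENNReal.ofReal_ne_top⟩
  have hL1 : ∀ u ∈ S, ∫⁻ x in B, ‖zeroExt u x‖ₑ ≤ A₀ := fun u hu =>
    (lintegral_enorm_le_add hp.out _).trans (by
      refine add_le_add le_rfl ?_
      exact (hpoin _ (measurable_zeroExt u) fun x hx => zeroExt_of_notMem u hx).trans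
        (by gcongr; exact hu.2))
  have hint : ∀ u ∈ S, IntegrableOn (zeroExt u) B := fun u hu =>
    ⟨(measurable_zeroExt u).aestronglyMeasurable, (hL1 u hu).trans_lt hA₀t.lt_top⟩
  refine Metric.totallyBounded_of_finite_discretization fun ε hε => ?_
  -- The averages criterion is applied to differences, whose energy is at most `2 ^ (p - 1)` times
  -- the sum of the two bounds; `M ⊔ 0` allows for a negative `M`, truncated by `ENNReal.ofReal`.
  obtain ⟨Z, h, η, hh, hη, hZ, hsmall⟩ := exists_finite_averages hN c hr hp.out hs
    (2 ^ (p - 1) * (M ⊔ 0 + M ⊔ 0)) (δ := (ε / 2) ^ p) (by positivity)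
  set A := A₀.toReal with hA
  have hbound : ∀ u ∈ S, ∀ z ∈ Z, |∫ y in Metric.ball z h, zeroExt u y| ≤ A := by
    intro u hu z hz
    rw [← Real.norm_eq_abs, ← ENNReal.ofReal_le_iff_le_toReal hA₀t, ofReal_norm]
    exact (enorm_integral_le_lintegral_enorm _).trans
      ((lintegral_mono_set (hZ z hz)).trans (hL1 u hu))
  refine ⟨Z → Finset.Icc ⌊-A / η⌋ ⌊A / η⌋, inferInstance, fun u z =>
    ⟨⌊(∫ y in Metric.ball z.1 h, zeroExt u.1 y) / η⌋, ?_⟩, ?_⟩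
  · have := abs_le.1 (hbound u.1 u.2 z.1 z.2)
    exact Finset.mem_Icc.2 ⟨Int.floor_mono (by gcongr; exact this.1),
      Int.floor_mono (by gcongr; exact this.2)⟩
  · rintro ⟨u, hu⟩ ⟨v, hv⟩ huv
    have hsub := zeroExt_sub u v
    have hsub' : zeroExt (u - v) =ᵐ[volume.restrict B] fun x => zeroExt u x - zeroExt v x :=
      ae_restrict_of_ae hsub
    have h1 := hsmall (fun x => zeroExt u x - zeroExt v x)
      ((measurable_zeroExt u).sub (measurable_zeroExt v)) ((hint u hu).sub (hint v hv)) ?_ ?_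
    · have hzero : ∀ᵐ x, x ∉ B → zeroExt (u - v) x = 0 := by
        filter_upwards [hsub, hu.1, hv.1] with x h1 h2 h3 hx
        rw [h1, h2 hx, h3 hx, sub_zero]
      have h2 := ofReal_norm_rpow_of_ae_eq_zero hp.out hBm hzero
      rw [lintegral_congr_ae (g := fun x => ENNReal.ofReal (|zeroExt u x - zeroExt v x| ^ p))
        (by filter_upwards [hsub'] with x hx; rw [hx])] at h2
      have h3 := h2.trans_le h1
      rw [ENNReal.ofReal_le_ofReal_iff (by positivity),
        Real.rpow_le_rpow_iff (norm_nonneg _) (by positivity) hp0] at h3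
      rw [dist_eq_norm]
      linarith
    · have h2 := energy_add_le (B := B) (s := s) hp.out (measurable_zeroExt u)
        (b := fun x => -zeroExt v x)
      rw [energy_neg] at h2
      simp only [← sub_eq_add_neg] at h2
      refine h2.trans ?_
      rw [ENNReal.ofReal_mul (by positivity), ENNReal.ofReal_add (le_max_right _ _)
        (le_max_right _ _)]
      gcongr
      · exact hu.2.trans (ENNReal.ofReal_le_ofReal (le_max_left _ _))
      · exact hv.2.trans (ENNReal.ofReal_le_ofReal (le_max_left _ _))
    · intro z hz
      have h2 : ⌊(∫ y in Metric.ball z h, zeroExt u y) / η⌋ =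
          ⌊(∫ y in Metric.ball z h, zeroExt v y) / η⌋ :=
        congrArg Subtype.val (congrFun huv ⟨z, hz⟩)
      have h3 := Int.abs_sub_lt_one_of_floor_eq_floor h2
      rw [← sub_div, abs_div, abs_of_pos hη, div_lt_one hη] at h3
      rw [integral_sub ((hint u hu).mono_set (hZ z hz)) ((hint v hv).mono_set (hZ z hz))]
      exact h3.le

end Lp

/-! ### Fatou's lemma and uniform convexity of the energy -/

section semicontinuity

variable {N : ℕ} {Ω : Opens (E N)} {B : Set (E N)} {s p : ℝ} [hp : Fact (1 < p)]

/-- Fatou's lemma along a subsequence converging almost everywhere. -/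
theorem isClosed_energy_le (B : Set (E N)) (s : ℝ) (M : ℝ≥0∞) :
    IsClosed {u : LpOn Ω p | energy B s p (zeroExt u) ≤ M} := by
  have hp0 : 0 < p := by linarith [hp.out]
  refine IsSeqClosed.isClosed fun v u hv hvu => ?_
  have hmeas : TendstoInMeasure (volume.restrict (Ω : Set (E N))) (fun n => (v n : E N → ℝ))
      atTop u := tendstoInMeasure_of_tendsto_Lp hvu
  obtain ⟨ns, -, hns⟩ := hmeas.exists_seq_tendsto_ae
  have hae : ∀ᵐ x : E N, Tendsto (fun i => zeroExt (v (ns i)) x) atTop (𝓝 (zeroExt u x)) := by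
    filter_upwards [ae_imp_of_ae_restrict hns] with x hx
    by_cases h : x ∈ (Ω : Set (E N))
    · simpa only [zeroExt, Set.indicator_of_mem h] using hx h
    · simpa only [zeroExt, Set.indicator_of_notMem h] using tendsto_const_nhds
  have hae' : ∀ᵐ x ∂(volume.restrict B),
      Tendsto (fun i => zeroExt (v (ns i)) x) atTop (𝓝 (zeroExt u x)) := ae_restrict_of_ae hae
  have hm : ∀ i, Measurable (zeroExt (v i)) := fun i => measurable_zeroExt _
  have hfat := lintegral_liminf_le (u := atTop) (μ := (volume.restrict B).prod (volume.restrict B))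
    (f := fun i z => ENNReal.ofReal (|zeroExt (v (ns i)) z.1 - zeroExt (v (ns i)) z.2| ^ p /
      ‖z.1 - z.2‖ ^ ((N : ℝ) + s * p))) (fun i => by have := hm (ns i); fun_prop)
  simp only [← energy_eq_lintegral_prod] at hfat
  have hlim : energy B s p (zeroExt u) = ∫⁻ z, liminf (fun i =>
      ENNReal.ofReal (|zeroExt (v (ns i)) z.1 - zeroExt (v (ns i)) z.2| ^ p /
        ‖z.1 - z.2‖ ^ ((N : ℝ) + s * p))) atTop
        ∂((volume.restrict B).prod (volume.restrict B)) := by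
    rw [energy_eq_lintegral_prod]
    refine lintegral_congr_ae ?_
    filter_upwards [Measure.quasiMeasurePreserving_fst.ae hae',
      Measure.quasiMeasurePreserving_snd.ae hae'] with z h1 h2
    refine (Tendsto.liminf_eq (ENNReal.tendsto_ofReal (Tendsto.div_const ?_ _))).symm
    exact (h1.sub h2).abs.rpow_const (Or.inr hp0.le)
  refine (hlim.trans_le hfat).trans (liminf_le_of_le ?_ fun b hb => ?_)
  · isBoundedDefault
  · obtain ⟨i, hi⟩ := Eventually.exists hb
    exact hi.trans (hv (ns i))

/-- Uniform convexity turns approximation in `L^p` by a midpoint-closed set of bounded energy into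
approximation in energy. -/
theorem exists_energy_sub_le_of_mem_closure {A : Set (LpOn Ω p)}
    (hmid : ∀ u ∈ A, ∀ v ∈ A, (1 / 2 : ℝ) • (u + v) ∈ A) {M : ℝ}
    (hM : ∀ u ∈ A, energy B s p (zeroExt u) ≤ ENNReal.ofReal M) {u : LpOn Ω p}
    (hu : u ∈ closure A) {δ : ℝ} (hδ : 0 < δ) :
    ∃ w ∈ A, ‖w - u‖ ≤ δ ∧ energy B s p (zeroExt (w - u)) ≤ ENNReal.ofReal δ := by
  wlog hM0 : 0 ≤ M generalizing M
  · exact this (M := 0) (fun v hv => (hM v hv).trans (ENNReal.ofReal_le_ofReal (by linarith)))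
      le_rfl
  have hfin : ∀ v ∈ A, energy B s p (zeroExt v) ≠ ∞ := fun v hv =>
    ((hM v hv).trans_lt ENNReal.ofReal_lt_top).ne
  let e : LpOn Ω p → ℝ := fun v => (energy B s p (zeroExt v)).toReal
  have he0 : ∀ v, 0 ≤ e v := fun v => ENNReal.toReal_nonneg
  have heM : ∀ v ∈ A, e v ≤ M := fun v hv => ENNReal.toReal_le_of_le_ofReal hM0 (hM v hv)
  obtain ⟨K, hK, hconv⟩ := exists_energy_uniform_convexity (N := N) (B := B) (s := s) hp.out
    (ε := δ / (4 * (M + 1))) (by positivity)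
  set ε := δ / (4 * (M + 1)) with hε
  -- Uniform convexity will leave the error `2 ε (D + η) + 2 K η`; since `D + η ≤ M + 1`, the
  -- choices of `ε` and `η` make each term at most `δ / 2`.
  obtain ⟨η, hη, hη1, hηK⟩ : ∃ η : ℝ, 0 < η ∧ η ≤ 1 ∧ 4 * K * η ≤ δ := by
    refine ⟨min 1 (δ / (4 * (K + 1))), by positivity, min_le_left _ _, ?_⟩
    calc 4 * K * min 1 (δ / (4 * (K + 1))) ≤ 4 * (K + 1) * (δ / (4 * (K + 1))) := by
          gcongr
          · linarith
          · exact min_le_right _ _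
      _ = δ := by field_simp
  -- The infimum of the energy over these shrinking neighborhoods of `u` in `A` increases to a limit
  -- `D`, the relaxed energy of `u` along `A`.
  let An : ℕ → Set (LpOn Ω p) := fun n => A ∩ {v | ‖v - u‖ ≤ 1 / ((n : ℝ) + 1)}
  have hAn : ∀ n, (An n).Nonempty := fun n => by
    obtain ⟨v, hv, hd⟩ := Metric.mem_closure_iff.1 hu (1 / ((n : ℝ) + 1)) (by positivity)
    exact ⟨v, hv, by rw [dist_comm, dist_eq_norm] at hd; exact hd.le⟩
  have hAnti : ∀ {m n : ℕ}, n ≤ m → An m ⊆ An n := fun {m n} hmn v hv =>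
    ⟨hv.1, (show ‖v - u‖ ≤ _ from hv.2).trans (Nat.one_div_le_one_div hmn)⟩
  have hbdd : ∀ n, BddBelow (e '' An n) := fun n => ⟨0, by rintro _ ⟨v, -, rfl⟩; exact he0 v⟩
  let d : ℕ → ℝ := fun n => sInf (e '' An n)
  have hdM : ∀ n, d n ≤ M := fun n => by
    obtain ⟨v, hv⟩ := hAn n
    exact (csInf_le (hbdd n) ⟨v, hv, rfl⟩).trans (heM v hv.1)
  have hdb : BddAbove (Set.range d) := ⟨M, by rintro _ ⟨n, rfl⟩; exact hdM n⟩
  have hdmono : Monotone d := fun n m hnm =>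
    csInf_le_csInf (hbdd n) ((hAn m).image e) (Set.image_mono (hAnti hnm))
  set D := ⨆ n, d n with hD
  have hDM : D ≤ M := ciSup_le hdM
  obtain ⟨n₀, hn₀⟩ := exists_lt_of_lt_ciSup (show D - η < ⨆ n, d n by linarith)
  obtain ⟨n₁, hn₁⟩ := exists_nat_one_div_lt hδ
  set n := max n₀ n₁ with hn
  have hnD : D - η < d n := hn₀.trans_le (hdmono (le_max_left _ _))
  have hnδ : 1 / ((n : ℝ) + 1) ≤ δ := 
    (Nat.one_div_le_one_div (le_max_right _ _)).trans hn₁.le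
  let G : Set (LpOn Ω p) := {v ∈ An n | e v < D + η}
  -- The infimum over every smaller neighborhood is still at most `D`, so the almost minimizers
  -- accumulate at `u`.
  have hG : ∀ m, n ≤ m → ∃ v ∈ G, ‖v - u‖ ≤ 1 / ((m : ℝ) + 1) := fun m hm => by
    obtain ⟨_, ⟨v, hv, rfl⟩, hlt⟩ := exists_lt_of_csInf_lt ((hAn m).image e)
      (show sInf (e '' An m) < D + η by linarith [le_ciSup hdb m])
    exact ⟨v, ⟨hAnti hm hv, hlt⟩, hv.2⟩
  have huG : u ∈ closure G := by
    refine Metric.mem_closure_iff.2 fun r hr => ?_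
    obtain ⟨k, hk⟩ := exists_nat_one_div_lt hr
    obtain ⟨v, hv, hvu⟩ := hG (max n k) (le_max_left _ _)
    refine ⟨v, hv, ?_⟩
    rw [dist_comm, dist_eq_norm]
    refine (hvu.trans ?_).trans_lt hk
    exact Nat.one_div_le_one_div (le_max_right _ _)
  have hpair : ∀ v ∈ G, ∀ w ∈ G, energy B s p (zeroExt (v - w)) ≤ ENNReal.ofReal δ := by
    intro v hv w hw
    have hvw := hmid v hv.1.1 w hw.1.1
    have hmem : (1 / 2 : ℝ) • (v + w) ∈ An n := by
      refine ⟨hvw, ?_⟩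
      have h1 : (1 / 2 : ℝ) • (v + w) - u = (1 / 2 : ℝ) • ((v - u) + (w - u)) := by module
      simp only [Set.mem_ofPred_eq]
      rw [h1, norm_smul, Real.norm_eq_abs, abs_of_pos (by norm_num)]
      have h2 := hv.1.2
      have h3 := hw.1.2
      simp only [Set.mem_ofPred_eq] at h2 h3
      linarith [norm_add_le (v - u) (w - u)]
    -- The midpoint lies in the same convex neighborhood, so its energy cannot drop below the
    -- infimum there; almost minimizers must then be close in energy.
    have hlow : D - η < e ((1 / 2 : ℝ) • (v + w)) :=
      hnD.trans_le (csInf_le (hbdd n) ⟨_, hmem, rfl⟩)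
    have h1 := hconv (zeroExt v) (zeroExt w) (measurable_zeroExt v) (measurable_zeroExt w)
    rw [← energy_congr (zeroExt_sub v w), ← energy_congr (zeroExt_midpoint v w)] at h1
    have hev := hfin v hv.1.1
    have hew := hfin w hw.1.1
    have hem := hfin _ hvw
    have hrhs : ENNReal.ofReal (ε + K / 2) *
        (energy B s p (zeroExt v) + energy B s p (zeroExt w)) ≠ ∞ :=
      ENNReal.mul_ne_top ENNReal.ofReal_ne_top (ENNReal.add_ne_top.2 ⟨hev, hew⟩)
    have hes := (le_self_add.trans h1).trans_lt hrhs.lt_top |>.ne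
    have h2 := ENNReal.toReal_mono hrhs h1
    rw [ENNReal.toReal_add hes (ENNReal.mul_ne_top ENNReal.ofReal_ne_top hem),
      ENNReal.toReal_mul, ENNReal.toReal_mul, ENNReal.toReal_add hev hew,
      ENNReal.toReal_ofReal hK, ENNReal.toReal_ofReal (by positivity)] at h2
    rw [← ENNReal.ofReal_toReal hes]
    refine ENNReal.ofReal_le_ofReal ?_
    have h3 : e v < D + η := hv.2
    have h4 : e w < D + η := hw.2
    have h5 : K * (D - η) ≤ K * e ((1 / 2 : ℝ) • (v + w)) := by gcongr
    have h6 : (ε + K / 2) * (e v + e w) ≤ (ε + K / 2) * ((D + η) + (D + η)) := by gcongr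
    have h7 : ε * (D + η) ≤ δ / 4 := by
      calc ε * (D + η) ≤ ε * (M + 1) := by gcongr
        _ = δ / 4 := by rw [hε]; field_simp
    change _ + K * e ((1 / 2 : ℝ) • (v + w)) ≤ (ε + K / 2) * (e v + e w) at h2
    nlinarith
  obtain ⟨w, hw, -⟩ := hG n le_rfl
  refine ⟨w, hw.1.1, le_trans hw.1.2 hnδ, ?_⟩
  -- The bound is uniform over pairs in `G`, so Fatou's lemma lets the second element tend to `u`.
  have hcl : IsClosed {v : LpOn Ω p | energy B s p (zeroExt (w - v)) ≤ ENNReal.ofReal δ} :=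
    (isClosed_energy_le B s (ENNReal.ofReal δ)).preimage (continuous_const.sub continuous_id)
  exact closure_minimal (fun v hv => hpair w hw v hv) hcl huG

end semicontinuity

/-! ### The functionals: uniform bounds and closed sublevel sets -/

section functional

variable {N : ℕ} {Ω : Opens (E N)} {c : E N} {t p s : ℝ} [hp : Fact (1 < p)]

theorem functionalF_of_mem (f : relSobolev Ω c t p s →ₗ[ℝ] ℝ) {u : LpOn Ω p}
    (h : u ∈ relSobolev Ω c t p s) (hfin : energy (relBall Ω c t) s p (zeroExt u) ≠ ∞) :
    functionalF f u =
      (((energy (relBall Ω c t) s p (zeroExt u)).toReal / p + f ⟨u, h⟩ : ℝ) : EReal) := by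
  have hp0 : 0 < p := by linarith [hp.out]
  rw [functionalF, dif_pos h, EReal.coe_add]
  congr 1
  rw [← ENNReal.ofReal_toReal hfin, ← ENNReal.ofReal_mul (by positivity),
    EReal.coe_ennreal_ofReal, ENNReal.toReal_ofReal ENNReal.toReal_nonneg,
    max_eq_left (by positivity)]
  congr 1
  ring

theorem functionalF_le_coe_iff (f : relSobolev Ω c t p s →ₗ[ℝ] ℝ) (u : LpOn Ω p) (a : ℝ) :
    functionalF f u ≤ a ↔ ∃ h : u ∈ relSobolev Ω c t p s,
      energy (relBall Ω c t) s p (zeroExt u) ≠ ∞ ∧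
        (energy (relBall Ω c t) s p (zeroExt u)).toReal / p + f ⟨u, h⟩ ≤ a := by
  have hp0 : 0 < p := by linarith [hp.out]
  constructor
  · intro hle
    by_cases h : u ∈ relSobolev Ω c t p s
    · by_cases hfin : energy (relBall Ω c t) s p (zeroExt u) = ∞
      · rw [functionalF, dif_pos h, hfin, ENNReal.mul_top
          (ENNReal.ofReal_pos.2 (by positivity)).ne', EReal.coe_ennreal_top,
          EReal.top_add_coe] at hle
        exact absurd hle (not_le.2 (EReal.coe_lt_top a))
      · rw [functionalF_of_mem f h hfin] at hle
        exact ⟨h, hfin, EReal.coe_le_coe_iff.1 hle⟩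
    · rw [functionalF, dif_neg h] at hle
      exact absurd hle (not_le.2 (EReal.coe_lt_top a))
  · rintro ⟨h, hfin, hle⟩
    rw [functionalF_of_mem f h hfin]
    exact EReal.coe_le_coe_iff.2 hle

theorem mem_relSobolev_iff (u : LpOn Ω p) :
    u ∈ relSobolev Ω c t p s ↔ ∀ δ : ℝ, 0 < δ → ∃ φ : E N → ℝ, IsTest Ω φ ∧
      energy (relBall Ω c t) s p (fun x => zeroExt u x - φ x) ≤ ENNReal.ofReal δ := by
  constructor
  · rintro ⟨φ, hφ, hlim⟩ δ hδ
    obtain ⟨n, hn⟩ := (hlim.eventually_le_const (ENNReal.ofReal_pos.2 hδ)).exists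
    exact ⟨φ n, hφ n, hn⟩
  · intro h
    choose φ hφ hle using fun n : ℕ => h (1 / ((n : ℝ) + 1)) (by positivity)
    refine ⟨φ, hφ, tendsto_of_tendsto_of_tendsto_of_le_of_le tendsto_const_nhds ?_
      (fun _ => zero_le) hle⟩
    simpa using ENNReal.tendsto_ofReal tendsto_one_div_add_atTop_nhds_zero_nat

/-- The space is closed for its own seminorm, by the quasi-triangle inequality. -/
theorem mem_relSobolev_of_approx {u : LpOn Ω p}
    (h : ∀ δ : ℝ, 0 < δ → ∃ w ∈ relSobolev Ω c t p s,
      energy (relBall Ω c t) s p (zeroExt (w - u)) ≤ ENNReal.ofReal δ) :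
    u ∈ relSobolev Ω c t p s := by
  rw [mem_relSobolev_iff]
  intro δ hδ
  set k : ℝ := 2 ^ (p - 1) with hk
  have hk0 : 0 < k := by positivity
  obtain ⟨w, hw, hle⟩ := h (δ / (2 * k)) (by positivity)
  obtain ⟨φ, hφ, hφle⟩ := (mem_relSobolev_iff w).1 hw (δ / (2 * k)) (by positivity)
  refine ⟨φ, hφ, ?_⟩
  rw [energy_congr (zeroExt_sub w u), energy_sub_comm] at hle
  have h1 := energy_add_le (B := relBall Ω c t) (s := s) hp.out
    (a := fun x => zeroExt u x - zeroExt w x) (b := fun x => zeroExt w x - φ x)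
    ((measurable_zeroExt u).sub (measurable_zeroExt w))
  simp only [sub_add_sub_cancel] at h1
  refine h1.trans ?_
  calc _ ≤ ENNReal.ofReal k * (ENNReal.ofReal (δ / (2 * k)) + ENNReal.ofReal (δ / (2 * k))) := by
        gcongr
    _ = ENNReal.ofReal δ := by
        rw [← ENNReal.ofReal_add (by positivity) (by positivity), ← ENNReal.ofReal_mul hk0.le]
        congr 1
        field_simp
        norm_num

theorem mem_relSobolev_congr {u v : LpOn Ω p}
    (huv : zeroExt u =ᵐ[volume.restrict (relBall Ω c t)] zeroExt v)
    (hu : u ∈ relSobolev Ω c t p s) : v ∈ relSobolev Ω c t p s := by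
  refine mem_relSobolev_of_approx fun δ hδ => ⟨u, hu, ?_⟩
  have : zeroExt (u - v) =ᵐ[volume.restrict (relBall Ω c t)] fun _ => 0 := by
    filter_upwards [ae_restrict_of_ae (zeroExt_sub u v), huv] with x h1 h2
    rw [h1, h2, sub_self]
  rw [energy_congr_on this, energy_zero hp.out]
  exact zero_le

theorem IsBoundedFunctional.exists_abs_le {f : relSobolev Ω c t p s →ₗ[ℝ] ℝ}
    (hf : IsBoundedFunctional f) : ∃ C : ℝ, 0 ≤ C ∧ ∀ u : relSobolev Ω c t p s, ∀ X : ℝ, 0 ≤ X →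
      energy (relBall Ω c t) s p (zeroExt u.1) ≤ ENNReal.ofReal X → |f u| ≤ C * X ^ (1 / p) := by
  have hp0 : 0 < p := by linarith [hp.out]
  obtain ⟨C, hC⟩ := hf
  refine ⟨C, C.2, fun u X hX hle => ?_⟩
  have h1 := (hC u).trans (mul_le_mul_right (ENNReal.rpow_le_rpow hle (by positivity)) _)
  rw [ENNReal.ofReal_rpow_of_nonneg hX (by positivity), ← ENNReal.ofReal_coe_nnreal,
    ← ENNReal.ofReal_mul C.coe_nonneg] at h1
  exact (ENNReal.ofReal_le_ofReal_iff (by positivity)).1 h1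

theorem IsBoundedFunctional.map_congr {f : relSobolev Ω c t p s →ₗ[ℝ] ℝ}
    (hf : IsBoundedFunctional f) {u v : relSobolev Ω c t p s}
    (huv : zeroExt u.1 =ᵐ[volume.restrict (relBall Ω c t)] zeroExt v.1) : f u = f v := by
  have hp0 : 0 < p := by linarith [hp.out]
  obtain ⟨C, -, hC⟩ := hf.exists_abs_le
  have h0 : zeroExt (u - v).1 =ᵐ[volume.restrict (relBall Ω c t)] fun _ => 0 := by
    filter_upwards [ae_restrict_of_ae (zeroExt_sub u.1 v.1), huv] with x h1 h2
    rw [Submodule.coe_sub, h1, h2, sub_self]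
  have h1 := hC (u - v) 0 le_rfl (by rw [energy_congr_on h0, energy_zero hp.out]; exact zero_le)
  rw [Real.zero_rpow (by positivity), mul_zero, map_sub] at h1
  exact sub_eq_zero.1 (abs_nonpos_iff.1 h1)

/-- With `Y = X ^ (1 / p)`, the term `Y ^ p / p` outgrows an affine function of `Y` because `p > 1`.
-/
theorem exists_bound_of_div_le_add_rpow {p : ℝ} (hp : 1 < p) (a C : ℝ) :
    ∃ X₀ : ℝ, 0 ≤ X₀ ∧ ∀ X : ℝ, 0 ≤ X → X / p ≤ a + C * X ^ (1 / p) → X ≤ X₀ := by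
  have hp0 : 0 < p := by linarith
  obtain ⟨Y₀, hY₀⟩ := eventually_atTop.1 ((tendsto_rpow_atTop (sub_pos.2 hp)).eventually_gt_atTop
    (p * (|C| + |a|)))
  refine ⟨(max Y₀ 1) ^ p, by positivity, fun X hX hle => ?_⟩
  by_contra! hlt
  set Y := X ^ (1 / p) with hY
  have hXY : X = Y ^ p := by rw [hY, ← Real.rpow_mul hX, one_div_mul_cancel hp0.ne', Real.rpow_one]
  have hY0 : 0 ≤ Y := by positivity
  have hYlt : max Y₀ 1 < Y := by
    rw [hXY] at hlt
    exact (Real.rpow_lt_rpow_iff (by positivity) hY0 hp0).1 hlt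
  have hY1 : 1 < Y := (le_max_right _ _).trans_lt hYlt
  have h1 := hY₀ Y ((le_max_left _ _).trans hYlt.le)
  have h2 : Y ^ p = Y ^ (p - 1) * Y := by
    rw [← Real.rpow_add_one (by linarith)]
    congr 1
    ring
  rw [hXY, h2, div_le_iff₀ hp0] at hle
  have h3 : p * (|C| + |a|) * Y < Y ^ (p - 1) * Y := by gcongr
  have h4 : a ≤ |a| * Y := by nlinarith [le_abs_self a, abs_nonneg a]
  have h5 : C * Y ≤ |C| * Y := by gcongr; exact le_abs_self C
  nlinarith

/-- The bound is uniform in the order `s'`: comparing orders costs only the constant `D`, which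
enters the estimate of `f` as `D ^ (1 / p)`. -/
theorem IsBoundedFunctional.exists_energy_bound {f : relSobolev Ω c t p s →ₗ[ℝ] ℝ}
    (hf : IsBoundedFunctional f) (a : ℝ) {D : ℝ} (hD : 0 ≤ D) :
    ∃ X₀ : ℝ, 0 ≤ X₀ ∧ ∀ (s' : ℝ) (h : s ≤ s'),
      (t * Metric.diam (Ω : Set (E N))) ^ ((s' - s) * p) ≤ D → ∀ u : LpOn Ω p,
      functionalF (f ∘ₗ Submodule.inclusion (relSobolev_anti Ω c t p h)) u ≤ a →
        energy (relBall Ω c t) s' p (zeroExt u) ≤ ENNReal.ofReal X₀ := by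
  have hp0 : 0 < p := by linarith [hp.out]
  obtain ⟨C, hC0, hC⟩ := hf.exists_abs_le
  obtain ⟨X₀, hX₀, hX⟩ := exists_bound_of_div_le_add_rpow hp.out a (C * D ^ (1 / p))
  refine ⟨X₀, hX₀, fun s' h hsD u hu => ?_⟩
  obtain ⟨hmem, hfin, hle⟩ := (functionalF_le_coe_iff _ _ _).1 hu
  rw [← ENNReal.ofReal_toReal hfin]
  set X := (energy (relBall Ω c t) s' p (zeroExt u)).toReal with hXdef
  have hX0 : 0 ≤ X := ENNReal.toReal_nonneg
  refine ENNReal.ofReal_le_ofReal (hX X hX0 ?_)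
  have h1 := hC (Submodule.inclusion (relSobolev_anti Ω c t p h) ⟨u, hmem⟩) (D * X)
    (by positivity) (by
      refine (energy_mono_order hp.out h _).trans ?_
      rw [ENNReal.ofReal_mul hD, hXdef, ENNReal.ofReal_toReal hfin]
      exact mul_le_mul_left (ENNReal.ofReal_le_ofReal hsD) _)
  rw [Real.mul_rpow hD hX0, ← mul_assoc] at h1
  rw [LinearMap.comp_apply] at hle
  linarith [neg_abs_le (f (Submodule.inclusion (relSobolev_anti Ω c t p h) ⟨u, hmem⟩))]

/-- The sublevel set is midpoint-convex with bounded energy, so an `L^p` limit point is also a limit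
in energy of elements of the set. This puts it in the closure of the test functions and makes `f`,
continuous only for the energy, converge. -/
theorem IsBoundedFunctional.isClosed_sublevel {f : relSobolev Ω c t p s →ₗ[ℝ] ℝ}
    (hf : IsBoundedFunctional f) (a : ℝ) : IsClosed {u : LpOn Ω p | functionalF f u ≤ a} := by
  have hp0 : 0 < p := by linarith [hp.out]
  set B := relBall Ω c t with hB
  set A := {u : LpOn Ω p | functionalF f u ≤ a} with hA
  obtain ⟨X₀, hX₀, hbound⟩ := hf.exists_energy_bound a (D := 1) zero_le_one
  have hM : ∀ u ∈ A, energy B s p (zeroExt u) ≤ ENNReal.ofReal X₀ := fun u hu =>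
    hbound s le_rfl (by simp) u hu
  have hmid : ∀ u ∈ A, ∀ v ∈ A, (1 / 2 : ℝ) • (u + v) ∈ A := by
    intro u hu v hv
    obtain ⟨hu1, hu2, hu3⟩ := (functionalF_le_coe_iff _ _ _).1 hu
    obtain ⟨hv1, hv2, hv3⟩ := (functionalF_le_coe_iff _ _ _).1 hv
    have hE := energy_midpoint_le (B := B) (s := s) hp.out (measurable_zeroExt u)
      (b := zeroExt v)
    rw [← energy_congr (zeroExt_midpoint u v)] at hE
    have hrt : ENNReal.ofReal (1 / 2) *
        (energy B s p (zeroExt u) + energy B s p (zeroExt v)) ≠ ∞ :=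
      ENNReal.mul_ne_top ENNReal.ofReal_ne_top (ENNReal.add_ne_top.2 ⟨hu2, hv2⟩)
    refine (functionalF_le_coe_iff _ _ _).2 ⟨Submodule.smul_mem _ _ (Submodule.add_mem _ hu1 hv1),
      (hE.trans_lt hrt.lt_top).ne, ?_⟩
    have h1 := ENNReal.toReal_mono hrt hE
    rw [ENNReal.toReal_mul, ENNReal.toReal_add hu2 hv2, ENNReal.toReal_ofReal (by norm_num)] at h1
    have h2 : f ⟨(1 / 2 : ℝ) • (u + v),
        Submodule.smul_mem _ _ (Submodule.add_mem _ hu1 hv1)⟩ =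
        (1 / 2 : ℝ) * (f ⟨u, hu1⟩ + f ⟨v, hv1⟩) := by
      rw [← map_add, ← smul_eq_mul, ← map_smul]
      rfl
    rw [h2]
    have h3 := div_le_div_of_nonneg_right h1 hp0.le
    have h4 : 1 / 2 * ((energy B s p (zeroExt u)).toReal + (energy B s p (zeroExt v)).toReal) / p
      = 1 / 2 * ((energy B s p (zeroExt u)).toReal / p + (energy B s p (zeroExt v)).toReal / p) := by
      ring
    linarith
  refine isClosed_of_closure_subset fun u hu => ?_
  have happ : ∀ δ : ℝ, 0 < δ → ∃ w ∈ A, ‖w - u‖ ≤ δ ∧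
      energy B s p (zeroExt (w - u)) ≤ ENNReal.ofReal δ := fun δ hδ =>
    exists_energy_sub_le_of_mem_closure hmid hM hu hδ
  have hmemA : ∀ w ∈ A, w ∈ relSobolev Ω c t p s := fun w hw =>
    ((functionalF_le_coe_iff _ _ _).1 hw).1
  have hus : u ∈ relSobolev Ω c t p s := mem_relSobolev_of_approx fun δ hδ => by
    obtain ⟨w, hw, -, hle⟩ := happ δ hδ
    exact ⟨w, hmemA w hw, hle⟩
  choose w hw hwu hwe using fun n : ℕ => happ (1 / ((n : ℝ) + 1)) (by positivity)
  have hwlim : Tendsto w atTop (𝓝 u) := by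
    rw [tendsto_iff_norm_sub_tendsto_zero]
    exact squeeze_zero (fun _ => norm_nonneg _) hwu tendsto_one_div_add_atTop_nhds_zero_nat
  obtain ⟨C, hC0, hC⟩ := hf.exists_abs_le
  have hflim : Tendsto (fun n => f ⟨w n, hmemA _ (hw n)⟩) atTop (𝓝 (f ⟨u, hus⟩)) := by
    rw [tendsto_iff_norm_sub_tendsto_zero]
    have hz : Tendsto (fun n : ℕ => C * (1 / ((n : ℝ) + 1)) ^ (1 / p)) atTop (𝓝 0) := by
      have := (tendsto_one_div_add_atTop_nhds_zero_nat (𝕜 := ℝ)).rpow_const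
        (p := 1 / p) (Or.inr (by positivity))
      rw [Real.zero_rpow (by positivity)] at this
      simpa using this.const_mul C
    refine squeeze_zero (fun _ => norm_nonneg _) (fun n => ?_) hz
    rw [← map_sub, Real.norm_eq_abs]
    exact hC _ _ (by positivity) (hwe n)
  have hwA : ∀ n, (energy B s p (zeroExt (w n))).toReal ≤ p * (a - f ⟨w n, hmemA _ (hw n)⟩) :=
    fun n => by
      have h3 : (energy B s p (zeroExt (w n))).toReal / p + f ⟨w n, hmemA _ (hw n)⟩ ≤ a :=
        ((functionalF_le_coe_iff _ _ _).1 (hw n)).2.2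
      have : (energy B s p (zeroExt (w n))).toReal / p ≤ a - f ⟨w n, hmemA _ (hw n)⟩ := by linarith
      rwa [div_le_iff₀' hp0] at this
  have hrlim : Tendsto (fun n => p * (a - f ⟨w n, hmemA _ (hw n)⟩)) atTop
      (𝓝 (p * (a - f ⟨u, hus⟩))) := (hflim.const_sub a).const_mul p
  have hr0 : 0 ≤ p * (a - f ⟨u, hus⟩) :=
    ge_of_tendsto' hrlim fun n => ENNReal.toReal_nonneg.trans (hwA n)
  have hEu : energy B s p (zeroExt u) ≤ ENNReal.ofReal (p * (a - f ⟨u, hus⟩)) := by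
    -- The energy bounds along `w` vary with `n` but are eventually below their limit plus `η`, a
    -- fixed level to which Fatou's lemma applies.
    refine ENNReal.le_of_forall_pos_le_add fun η hη _ => ?_
    rw [← ENNReal.ofReal_coe_nnreal, ← ENNReal.ofReal_add hr0 η.coe_nonneg]
    refine (isClosed_energy_le B s _).mem_of_tendsto hwlim ?_
    filter_upwards [hrlim.eventually_le_const
      (show p * (a - f ⟨u, hus⟩) < p * (a - f ⟨u, hus⟩) + η by
        have : (0 : ℝ) < η := hη
        linarith)] with n hn
    have hfin := ((hM _ (hw n)).trans_lt ENNReal.ofReal_lt_top).ne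
    change energy B s p (zeroExt (w n)) ≤ _
    rw [← ENNReal.ofReal_toReal hfin]
    exact ENNReal.ofReal_le_ofReal ((hwA n).trans hn)
  refine (functionalF_le_coe_iff _ _ _).2 ⟨hus, (hEu.trans_lt ENNReal.ofReal_lt_top).ne, ?_⟩
  have h1 := ENNReal.toReal_le_of_le_ofReal hr0 hEu
  rw [mul_comm, ← div_le_iff₀ hp0] at h1
  linarith

end functional

/-! ### Energies of test functions -/

section testFunctions

variable {N : ℕ} {Ω : Opens (E N)} {p : ℝ}

theorem lintegral_ball_norm_rpow_lt_top (hN : 1 ≤ N) {β : ℝ} (hβ : 0 < β) (r : ℝ) :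
    ∫⁻ z in Metric.ball (0 : E N) r, ENNReal.ofReal (‖z‖ ^ (β - N)) < ∞ := by
  have : Nonempty (Fin N) := ⟨⟨0, hN⟩⟩
  have h : IntegrableOn (fun z : E N => ‖z‖ ^ (β - N)) (Metric.ball 0 r) := by
    refine (integrableOn_fun_norm_addHaar volume (f := fun y : ℝ => y ^ (β - N))).2 ?_
    rw [finrank_euclideanSpace_fin]
    rcases le_or_gt r 0 with hr | hr
    · rw [Set.Ioo_eq_empty (not_lt.2 hr)]
      exact integrableOn_empty
    have h1 : IntegrableOn (fun y : ℝ => y ^ (β - 1)) (Set.Ioo 0 r) := by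
      have := intervalIntegral.intervalIntegrable_rpow' (a := 0) (b := r)
        (show -1 < β - 1 by linarith)
      exact ((intervalIntegrable_iff_integrableOn_Ioc_of_le hr.le).1 this).mono_set
        Set.Ioo_subset_Ioc_self
    refine h1.congr_fun (fun y hy => ?_) measurableSet_Ioo
    simp only [smul_eq_mul]
    rw [← Real.rpow_natCast, ← Real.rpow_add hy.1, Nat.cast_sub hN]
    congr 1
    push_cast
    ring
  have h2 := h.2
  refine lt_of_le_of_lt (le_of_eq ?_) h2
  refine lintegral_congr fun z => ?_
  rw [Real.enorm_eq_ofReal (by positivity)]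

/-- The Lipschitz bound reduces the kernel to `|x - y| ^ (p (1 - s) - N)`, which is integrable near
the diagonal precisely because `s < 1`. -/
theorem IsTest.energy_lt_top (hN : 1 ≤ N) (hp : 1 < p) {φ : E N → ℝ} (hφ : IsTest Ω φ)
    (c : E N) (r : ℝ) {s : ℝ} (hs1 : s < 1) : energy (Metric.ball c r) s p φ < ∞ := by
  have hp0 : 0 < p := by linarith
  obtain ⟨L, hL⟩ := hφ.1.lipschitzWith_of_hasCompactSupport hφ.2.1 (by simp)
  set β := p * (1 - s) with hβ
  have hβ0 : 0 < β := mul_pos hp0 (by linarith)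
  have hbound : ∀ x y : E N, |φ x - φ y| ^ p / ‖x - y‖ ^ ((N : ℝ) + s * p) ≤
      (L : ℝ) ^ p * ‖x - y‖ ^ (β - N) := by
    intro x y
    rcases eq_or_ne x y with rfl | hne
    · simp only [sub_self, abs_zero, Real.zero_rpow hp0.ne', zero_div]
      positivity
    have hd : 0 < ‖x - y‖ := norm_pos_iff.2 (sub_ne_zero.2 hne)
    have h1 : |φ x - φ y| ≤ L * ‖x - y‖ := by
      have := hL.dist_le_mul x y
      rwa [dist_eq_norm, dist_eq_norm] at this
    rw [div_le_iff₀ (by positivity), mul_assoc, ← Real.rpow_add hd,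
      show β - N + ((N : ℝ) + s * p) = p by rw [hβ]; ring, ← Real.mul_rpow L.coe_nonneg hd.le]
    exact Real.rpow_le_rpow (abs_nonneg _) h1 hp0.le
  set I := ∫⁻ z in Metric.ball (0 : E N) (2 * r), ENNReal.ofReal (‖z‖ ^ (β - N)) with hI
  have hIt : I < ∞ := lintegral_ball_norm_rpow_lt_top hN hβ0 _
  rw [energy_eq_lintegral_lintegral _ _ _ hφ.1.continuous.measurable]
  calc ∫⁻ x in Metric.ball c r, ∫⁻ y in Metric.ball c r,
        ENNReal.ofReal (|φ x - φ y| ^ p / ‖x - y‖ ^ ((N : ℝ) + s * p))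
      ≤ ∫⁻ _ in Metric.ball c r, ENNReal.ofReal ((L : ℝ) ^ p) * I := by
        refine setLIntegral_mono' Metric.isOpen_ball.measurableSet fun x hx => ?_
        calc _ ≤ ∫⁻ y, ENNReal.ofReal ((L : ℝ) ^ p) * (Metric.ball (0 : E N) (2 * r)).indicator
              (fun z => ENNReal.ofReal (‖z‖ ^ (β - N))) (x - y) := by
              rw [← lintegral_indicator Metric.isOpen_ball.measurableSet]
              refine lintegral_mono fun y => ?_
              by_cases hy : y ∈ Metric.ball c r
              · have hxy : x - y ∈ Metric.ball (0 : E N) (2 * r) := by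
                  rw [mem_ball_zero_iff, ← dist_eq_norm]
                  have h1 := Metric.mem_ball.1 hx
                  have h2 := Metric.mem_ball'.1 hy
                  linarith [dist_triangle x c y]
                simp only [Set.indicator_of_mem hy, Set.indicator_of_mem hxy]
                rw [← ENNReal.ofReal_mul (by positivity)]
                exact ENNReal.ofReal_le_ofReal (hbound x y)
              · rw [Set.indicator_of_notMem hy]
                exact zero_le
          _ = ENNReal.ofReal ((L : ℝ) ^ p) * I := by
              rw [lintegral_const_mul' _ _ ENNReal.ofReal_ne_top, lintegral_sub_left_eq_self
                ((Metric.ball (0 : E N) (2 * r)).indicator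
                  fun z => ENNReal.ofReal (‖z‖ ^ (β - N))) x,
                lintegral_indicator Metric.isOpen_ball.measurableSet]
    _ < ∞ := by
        rw [setLIntegral_const]
        exact ENNReal.mul_lt_top (ENNReal.mul_lt_top ENNReal.ofReal_lt_top hIt) measure_ball_lt_top

/-- Dominated convergence: where `|x - y| ≥ 1` the kernel of order `s` dominates, where `|x - y| ≤
1` that of order `s'`, and their sum is integrable since `s' < 1`. -/
theorem IsTest.tendsto_energy (hN : 1 ≤ N) (hp : 1 < p) {φ : E N → ℝ} (hφ : IsTest Ω φ)
    (c : E N) (r : ℝ) {s s' : ℝ} (hs' : s' < 1) {σ : ℕ → ℝ} (hσ : ∀ j, σ j ∈ Set.Icc s s')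
    (hlim : Tendsto σ atTop (𝓝 s)) :
    Tendsto (fun j => energy (Metric.ball c r) (σ j) p φ) atTop
      (𝓝 (energy (Metric.ball c r) s p φ)) := by
  have hp0 : 0 < p := by linarith
  have hm : Measurable φ := hφ.1.continuous.measurable
  have hss : s ≤ s' := (hσ 0).1.trans (hσ 0).2
  refine tendsto_lintegral_of_dominated_convergence (fun z : E N × E N =>
    ENNReal.ofReal (|φ z.1 - φ z.2| ^ p / ‖z.1 - z.2‖ ^ ((N : ℝ) + s * p)) +
      ENNReal.ofReal (|φ z.1 - φ z.2| ^ p / ‖z.1 - z.2‖ ^ ((N : ℝ) + s' * p)))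
    (fun j => by fun_prop) (fun j => ae_of_all _ fun z => ?_) ?_ (ae_of_all _ fun z => ?_)
  · simp only
    rcases eq_or_ne z.1 z.2 with he | hne
    · simp [he, Real.zero_rpow hp0.ne']
    have hd : 0 < ‖z.1 - z.2‖ := norm_pos_iff.2 (sub_ne_zero.2 hne)
    rcases le_total 1 ‖z.1 - z.2‖ with h1 | h1
    · refine le_add_right (ENNReal.ofReal_le_ofReal ?_)
      refine div_le_div_of_nonneg_left (by positivity) (by positivity)
        (Real.rpow_le_rpow_of_exponent_le h1 ?_)
      gcongr
      exact (hσ j).1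
    · refine le_add_left (ENNReal.ofReal_le_ofReal ?_)
      refine div_le_div_of_nonneg_left (by positivity) (by positivity)
        (Real.rpow_le_rpow_of_exponent_ge hd h1 ?_)
      gcongr
      exact (hσ j).2
  · rw [lintegral_add_left (by fun_prop)]
    exact (ENNReal.add_lt_top.2 ⟨hφ.energy_lt_top hN hp c r (hss.trans_lt hs'),
      hφ.energy_lt_top hN hp c r hs'⟩).ne
  · rcases eq_or_ne z.1 z.2 with he | hne
    · simp [he, Real.zero_rpow hp0.ne']
    have hd : 0 < ‖z.1 - z.2‖ := norm_pos_iff.2 (sub_ne_zero.2 hne)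
    refine ENNReal.tendsto_ofReal (Tendsto.div tendsto_const_nhds
      (Tendsto.rpow tendsto_const_nhds ?_ (Or.inl hd.ne')) (by positivity))
    exact (hlim.mul_const p).const_add _

theorem IsTest.memLp {φ : E N → ℝ} (hφ : IsTest Ω φ) :
    MemLp φ (ENNReal.ofReal p) (volume.restrict (Ω : Set (E N))) :=
  (hφ.1.continuous.memLp_of_hasCompactSupport hφ.2.1).restrict _

theorem IsTest.zeroExt_toLp {φ : E N → ℝ} (hφ : IsTest Ω φ) :
    zeroExt (hφ.memLp.toLp φ : LpOn Ω p) =ᵐ[volume] φ := by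
  have h : (Ω : Set (E N)).indicator φ = φ :=
    Set.indicator_eq_self.2 ((subset_tsupport φ).trans hφ.2.2)
  simpa only [h] using FracGamma.zeroExt_toLp (Ω := Ω) (p := p) hφ.memLp

theorem IsTest.mem_relSobolev {c : E N} {t : ℝ} [hp : Fact (1 < p)] {φ : E N → ℝ}
    (hφ : IsTest Ω φ) {u : LpOn Ω p}
    (hu : zeroExt u =ᵐ[volume.restrict (relBall Ω c t)] φ) (s : ℝ) :
    u ∈ relSobolev Ω c t p s := by
  refine (mem_relSobolev_iff u).2 fun δ hδ => ⟨φ, hφ, ?_⟩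
  have : (fun x => zeroExt u x - φ x) =ᵐ[volume.restrict (relBall Ω c t)] fun _ => 0 := by
    filter_upwards [hu] with x hx
    rw [hx, sub_self]
  rw [energy_congr_on this, energy_zero hp.out]
  exact zero_le

theorem energy_ne_top_of_mem_relSobolev (hN : 1 ≤ N) {c : E N} {t s : ℝ} [hp : Fact (1 < p)]
    (hs1 : s < 1) {u : LpOn Ω p} (hu : u ∈ relSobolev Ω c t p s) :
    energy (relBall Ω c t) s p (zeroExt u) ≠ ∞ := by
  obtain ⟨φ, hφ, hle⟩ := (mem_relSobolev_iff u).1 hu 1 one_pos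
  have h := energy_add_le (B := relBall Ω c t) (s := s) hp.out
    (a := fun x => zeroExt u x - φ x) (b := φ)
    ((measurable_zeroExt u).sub hφ.1.continuous.measurable)
  simp only [sub_add_cancel] at h
  refine (h.trans_lt (ENNReal.mul_lt_top ENNReal.ofReal_lt_top (ENNReal.add_lt_top.2
    ⟨hle.trans_lt ENNReal.ofReal_lt_top, hφ.energy_lt_top hN hp.out _ _ hs1⟩))).ne

theorem tendsto_relDiam_rpow {t s : ℝ} (hD : 0 < t * Metric.diam (Ω : Set (E N))) {σ : ℕ → ℝ}
    (hlim : Tendsto σ atTop (𝓝 s)) :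
    Tendsto (fun j => (t * Metric.diam (Ω : Set (E N))) ^ ((σ j - s) * p)) atTop (𝓝 1) := by
  have h := Tendsto.rpow (tendsto_const_nhds (x := t * Metric.diam (Ω : Set (E N))))
    ((hlim.sub_const s).mul_const p) (Or.inl hD.ne')
  simpa using h

end testFunctions

/-! ### Diagonal construction of recovery sequences -/

section gammaConvergence

theorem le_coe_of_forall_pos_le_add {a : EReal} {g : ℝ}
    (h : ∀ δ : ℝ, 0 < δ → a ≤ ((g + δ : ℝ) : EReal)) : a ≤ g := by
  by_contra! hlt
  obtain ⟨b, h1, h2⟩ := EReal.lt_iff_exists_real_btwn.1 hlt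
  have h3 := h (b - g) (sub_pos.2 (EReal.coe_lt_coe_iff.1 h1))
  rw [add_sub_cancel] at h3
  exact absurd h2 (not_lt.2 h3)

/-- A diagonal argument producing recovery sequences from approximate ones. -/
theorem exists_recovery_sequence {X : Type*} [PseudoMetricSpace X] (F : ℕ → X → EReal) (u : X)
    (g : ℝ) (h : ∀ δ : ℝ, 0 < δ → ∃ x, dist x u < δ ∧
      ∀ᶠ j in atTop, F j x ≤ ((g + δ : ℝ) : EReal)) :
    ∃ v : ℕ → X, Tendsto v atTop (𝓝 u) ∧ limsup (fun j => F j (v j)) atTop ≤ g := by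
  choose x hx hF using fun n : ℕ => h (1 / ((n : ℝ) + 1)) (by positivity)
  choose n₀ hn₀ using fun n => eventually_atTop.1 (hF n)
  let k : ℕ → ℕ := fun j => Nat.findGreatest (fun n => n₀ n ≤ j) j
  have hk : Tendsto k atTop atTop := by
    refine tendsto_atTop.2 fun n => ?_
    filter_upwards [eventually_ge_atTop n, eventually_ge_atTop (n₀ n)] with j h1 h2
    exact Nat.le_findGreatest h1 h2
  -- `Nat.findGreatest` returns 0 by default when nothing qualifies, so its specification needs `j ≥
  -- n₀ 0`.
  have hk₀ : ∀ᶠ j in atTop, n₀ (k j) ≤ j := by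
    filter_upwards [eventually_ge_atTop (n₀ 0)] with j hj
    exact Nat.findGreatest_spec (P := fun n => n₀ n ≤ j) (Nat.zero_le j) hj
  have hz : Tendsto (fun j => 1 / ((k j : ℝ) + 1)) atTop (𝓝 0) :=
    tendsto_one_div_add_atTop_nhds_zero_nat.comp hk
  refine ⟨fun j => x (k j), ?_, ?_⟩
  · rw [tendsto_iff_dist_tendsto_zero]
    exact squeeze_zero (fun _ => dist_nonneg) (fun j => (hx (k j)).le) hz
  · refine le_coe_of_forall_pos_le_add fun δ hδ => ?_
    refine limsup_le_of_le (by isBoundedDefault) ?_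
    filter_upwards [hk₀, hz.eventually_le_const hδ] with j h1 h2
    refine (hn₀ (k j) j h1).trans (EReal.coe_le_coe_iff.2 ?_)
    linarith

end gammaConvergence

/-! ### Equi-coercivity and the two inequalities of Γ-convergence -/

section main

variable {N : ℕ} {Ω : Opens (E N)} {c : E N} {t p s : ℝ} [hp : Fact (1 < p)]

/-- Two functions that agree on `B` differ by a function of zero energy, on which the bounded
functional `f` vanishes. -/
theorem IsBoundedFunctional.functionalF_congr {f : relSobolev Ω c t p s →ₗ[ℝ] ℝ}
    (hf : IsBoundedFunctional f) {s' : ℝ} (h : s ≤ s') {u v : LpOn Ω p}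
    (huv : zeroExt u =ᵐ[volume.restrict (relBall Ω c t)] zeroExt v) :
    functionalF (f ∘ₗ Submodule.inclusion (relSobolev_anti Ω c t p h)) u =
      functionalF (f ∘ₗ Submodule.inclusion (relSobolev_anti Ω c t p h)) v := by
  by_cases hu : u ∈ relSobolev Ω c t p s'
  · have hv := mem_relSobolev_congr huv hu
    rw [functionalF, functionalF, dif_pos hu, dif_pos hv, energy_congr_on huv]
    congr 2
    exact hf.map_congr huv
  · have hv : v ∉ relSobolev Ω c t p s' := fun hv => hu (mem_relSobolev_congr huv.symm hv)
    rw [functionalF, functionalF, dif_neg hu, dif_neg hv]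

theorem functionalF_zero_le (f : relSobolev Ω c t p s →ₗ[ℝ] ℝ) : functionalF f 0 ≤ 0 := by
  have h0 : energy (relBall Ω c t) s p (zeroExt (0 : LpOn Ω p)) = 0 := by
    rw [energy_congr zeroExt_zero, energy_zero hp.out]
  refine (functionalF_le_coe_iff f 0 0).2
    ⟨Submodule.zero_mem _, by rw [h0]; exact ENNReal.zero_ne_top, ?_⟩
  rw [h0, ENNReal.toReal_zero, zero_div, zero_add]
  exact (map_zero f).le

theorem IsBoundedFunctional.equiCoercive (hN : 1 ≤ N) (hne : (Ω : Set (E N)).Nonempty)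
    (hbdd : Bornology.IsBounded (Ω : Set (E N))) (ht : 1 < t) (hs : 0 < s)
    {f : relSobolev Ω c t p s →ₗ[ℝ] ℝ} (hf : IsBoundedFunctional f) {σ : ℕ → ℝ}
    (hσ : ∀ j, s ≤ σ j) (hlim : Tendsto σ atTop (𝓝 s)) :
    EquiCoercive fun j =>
      functionalF (f ∘ₗ Submodule.inclusion (relSobolev_anti Ω c t p (hσ j))) := by
  have hR := diam_pos_of_nonempty hN hne hbdd
  have hBm : MeasurableSet (relBall Ω c t) := Metric.isOpen_ball.measurableSet
  obtain ⟨D, hD⟩ := (tendsto_relDiam_rpow (p := p) (show 0 < t * Metric.diam (Ω : Set (E N)) by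
    positivity) hlim).bddAbove_range
  have hD' : ∀ j, (t * Metric.diam (Ω : Set (E N))) ^ ((σ j - s) * p) ≤ D := fun j =>
    hD ⟨j, rfl⟩
  have hD0 : 0 ≤ D := le_trans (by positivity) (hD' 0)
  obtain ⟨X₀, hX₀, hbound⟩ := hf.exists_energy_bound 0 hD0
  have htb := totallyBounded_energy_le hN hne hbdd c ht (p := p) hs (D * X₀)
  obtain ⟨K, hK, hmem⟩ : ∃ K : Set (LpOn Ω p), IsCompact K ∧ ∀ v : LpOn Ω p,
      (∀ᵐ x, x ∉ relBall Ω c t → zeroExt v x = 0) →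
      energy (relBall Ω c t) s p (zeroExt v) ≤ ENNReal.ofReal (D * X₀) → v ∈ K :=
    ⟨_, isCompact_iff_totallyBounded_isComplete.2 ⟨htb.closure, isClosed_closure.isComplete⟩,
      fun v h1 h2 => subset_closure ⟨h1, h2⟩⟩
  refine ⟨K, hK, fun k => ?_⟩
  refine le_antisymm (le_iInf₂ fun u _ => iInf_le _ u) (le_iInf fun u => ?_)
  -- Every functional is at most 0 at the zero function, which lies in `K`; only competitors of
  -- nonpositive value need to be moved into `K`, by cutting off to `B`.
  by_cases hu : functionalF (f ∘ₗ Submodule.inclusion (relSobolev_anti Ω c t p (hσ k))) u ≤ 0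
  · refine (iInf₂_le (cutoff hBm u) (hmem _ ?_ ?_)).trans
      (hf.functionalF_congr (hσ k) (zeroExt_cutoff_restrict hBm u)).le
    · filter_upwards [zeroExt_cutoff hBm u] with x hx hxB
      rw [hx, Set.indicator_of_notMem hxB]
    · rw [energy_congr_on (zeroExt_cutoff_restrict hBm u), ENNReal.ofReal_mul hD0]
      refine (energy_mono_order hp.out (hσ k) _).trans ?_
      exact mul_le_mul' (ENNReal.ofReal_le_ofReal (hD' k)) (hbound _ (hσ k) (hD' k) u hu)
  · refine (iInf₂_le 0 (hmem _ ?_ ?_)).trans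
      ((functionalF_zero_le _).trans (not_le.1 hu).le)
    · filter_upwards [zeroExt_zero (Ω := Ω) (p := p)] with x hx _
      exact hx
    · rw [energy_congr zeroExt_zero, energy_zero hp.out]
      exact zero_le

/-- Passing from order `σ j` to order `s` multiplies the energy by at most a factor tending to 1; on
bounded energies the error vanishes, so the closed sublevel sets of the limit functional capture
`u`. -/
theorem IsBoundedFunctional.le_liminf (hN : 1 ≤ N) (hne : (Ω : Set (E N)).Nonempty)
    (hbdd : Bornology.IsBounded (Ω : Set (E N))) (ht : 1 < t)
    {f : relSobolev Ω c t p s →ₗ[ℝ] ℝ} (hf : IsBoundedFunctional f) {σ : ℕ → ℝ}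
    (hσ : ∀ j, s ≤ σ j) (hlim : Tendsto σ atTop (𝓝 s)) {u : LpOn Ω p} {v : ℕ → LpOn Ω p}
    (hv : Tendsto v atTop (𝓝 u)) :
    functionalF f u ≤ liminf (fun j => functionalF
      (f ∘ₗ Submodule.inclusion (relSobolev_anti Ω c t p (hσ j))) (v j)) atTop := by
  have hp0 : 0 < p := by linarith [hp.out]
  have hR := diam_pos_of_nonempty hN hne hbdd
  have hDlim := tendsto_relDiam_rpow (Ω := Ω) (p := p)
    (show 0 < t * Metric.diam (Ω : Set (E N)) by positivity) hlim
  obtain ⟨D, hD⟩ := hDlim.bddAbove_range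
  have hD' : ∀ j, (t * Metric.diam (Ω : Set (E N))) ^ ((σ j - s) * p) ≤ D := fun j =>
    hD ⟨j, rfl⟩
  have hD0 : 0 ≤ D := le_trans (by positivity) (hD' 0)
  by_contra! hlt
  obtain ⟨a, ha1, ha2⟩ := EReal.lt_iff_exists_real_btwn.1 hlt
  -- The gap between the two levels `a < b` absorbs the cost of changing the order.
  obtain ⟨b, hb1, hb2⟩ := EReal.lt_iff_exists_real_btwn.1 ha2
  have hab : a < b := EReal.coe_lt_coe_iff.1 hb1
  obtain ⟨X₀, hX₀, hbound⟩ := hf.exists_energy_bound a hD0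
  have hfreq := frequently_lt_of_liminf_lt (by isBoundedDefault) ha1
  have hev : ∀ᶠ j in atTop,
      (|(t * Metric.diam (Ω : Set (E N))) ^ ((σ j - s) * p) - 1| * X₀) / p ≤ b - a := by
    have h1 : Tendsto (fun j => (|(t * Metric.diam (Ω : Set (E N))) ^ ((σ j - s) * p) - 1| * X₀)
        / p) atTop (𝓝 ((|1 - 1| * X₀) / p)) :=
      (((hDlim.sub_const 1).abs).mul_const X₀).div_const p
    rw [sub_self, abs_zero, zero_mul, zero_div] at h1
    exact h1.eventually_le_const (sub_pos.2 hab)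
  have hmem : u ∈ {u : LpOn Ω p | functionalF f u ≤ b} := by
    rw [← (hf.isClosed_sublevel b).closure_eq]
    refine mem_closure_of_frequently_of_tendsto ((hfreq.and_eventually hev).mono ?_) hv
    rintro j ⟨hj1, hj2⟩
    obtain ⟨h1, h2, h3⟩ := (functionalF_le_coe_iff _ _ _).1 hj1.le
    have hE := hbound _ (hσ j) (hD' j) _ hj1.le
    have hmono := energy_mono_order (Ω := Ω) (c := c) (t := t) hp.out (hσ j) (zeroExt (v j))
    set d := (t * Metric.diam (Ω : Set (E N))) ^ ((σ j - s) * p) with hd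
    have hd0 : 0 ≤ d := by positivity
    set X := (energy (relBall Ω c t) (σ j) p (zeroExt (v j))).toReal with hX
    have hX0 : 0 ≤ X := ENNReal.toReal_nonneg
    have hXX : X ≤ X₀ := ENNReal.toReal_le_of_le_ofReal hX₀ hE
    rw [← ENNReal.ofReal_toReal h2, ← ENNReal.ofReal_mul hd0] at hmono
    refine (functionalF_le_coe_iff _ _ _).2 ⟨relSobolev_anti Ω c t p (hσ j) h1,
      (hmono.trans_lt ENNReal.ofReal_lt_top).ne, ?_⟩
    have h4 := ENNReal.toReal_le_of_le_ofReal (by positivity) hmono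
    have h5 : d * X ≤ X + |d - 1| * X₀ := by
      calc d * X = X + (d - 1) * X := by ring
        _ ≤ X + |d - 1| * X₀ := by
          gcongr
          exact le_abs_self _
    have h6 := div_le_div_of_nonneg_right (h4.trans h5) hp0.le
    rw [add_div] at h6
    rw [LinearMap.comp_apply] at h3
    change _ + f (Submodule.inclusion (relSobolev_anti Ω c t p (hσ j)) ⟨v j, h1⟩) ≤ b
    linarith
  exact absurd hb2 (not_lt.2 hmem)

theorem IsBoundedFunctional.exists_recovery (hN : 1 ≤ N) (hne : (Ω : Set (E N)).Nonempty)
    (hbdd : Bornology.IsBounded (Ω : Set (E N))) (ht : 1 < t) (hs : 0 < s)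
    {f : relSobolev Ω c t p s →ₗ[ℝ] ℝ} (hf : IsBoundedFunctional f) {σ : ℕ → ℝ} {s' : ℝ}
    (hs' : s' < 1) (hσ : ∀ j, s ≤ σ j) (hσ' : ∀ j, σ j ≤ s') (hlim : Tendsto σ atTop (𝓝 s))
    (u : LpOn Ω p) :
    ∃ v : ℕ → LpOn Ω p, Tendsto v atTop (𝓝 u) ∧ limsup (fun j => functionalF
      (f ∘ₗ Submodule.inclusion (relSobolev_anti Ω c t p (hσ j))) (v j)) atTop ≤
        functionalF f u := by
  have hp0 : 0 < p := by linarith [hp.out]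
  have hBm : MeasurableSet (relBall Ω c t) := Metric.isOpen_ball.measurableSet
  have hs1 : s < 1 := ((hσ 0).trans (hσ' 0)).trans_lt hs'
  by_cases hu : u ∈ relSobolev Ω c t p s
  swap
  · refine ⟨fun _ => u, tendsto_const_nhds, ?_⟩
    rw [functionalF, dif_neg hu]
    exact le_top
  have hfin := energy_ne_top_of_mem_relSobolev hN hs1 hu
  rw [functionalF_of_mem f hu hfin]
  set X := (energy (relBall Ω c t) s p (zeroExt u)).toReal with hX
  have hX0 : 0 ≤ X := ENNReal.toReal_nonneg
  refine exists_recovery_sequence _ u _ fun δ hδ => ?_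
  obtain ⟨C, hC0, hC⟩ := hf.exists_abs_le
  obtain ⟨P, hP0, hP⟩ := exists_poincare_const hN hne hbdd c ht hp.out hs
  -- `θ` is the tolerance of the approximation in the seminorm: the first condition gives `L^p`
  -- closeness through Poincaré, the second bounds the excess in energy and in `f` together.
  obtain ⟨θ, ⟨hθ1, hθ2⟩, hθ : 0 < θ⟩ : ∃ θ : ℝ, (P * θ ^ p < δ ^ p ∧
      (X ^ (1 / p) + θ) ^ p / p + C * θ < X / p + δ) ∧ 0 < θ := by
    have h1 : Tendsto (fun θ : ℝ => P * θ ^ p) (𝓝 0) (𝓝 (P * 0 ^ p)) :=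
      ((Real.continuous_rpow_const hp0.le).tendsto 0).const_mul P
    have h2 : Tendsto (fun θ : ℝ => (X ^ (1 / p) + θ) ^ p / p + C * θ) (𝓝 0)
        (𝓝 ((X ^ (1 / p) + 0) ^ p / p + C * 0)) :=
      ((((tendsto_id).const_add _).rpow_const (Or.inr hp0.le)).div_const p).add
        (tendsto_id.const_mul C)
    rw [Real.zero_rpow hp0.ne', mul_zero] at h1
    rw [add_zero, mul_zero, add_zero, ← Real.rpow_mul hX0, one_div_mul_cancel hp0.ne',
      Real.rpow_one] at h2
    exact (((h1.eventually_lt_const (show 0 < δ ^ p by positivity)).and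
      (h2.eventually_lt_const (show X / p < X / p + δ by linarith))).filter_mono
      (nhdsWithin_le_nhds (s := Set.Ioi 0)) |>.and self_mem_nhdsWithin).exists
  obtain ⟨φ, hφ, hφu⟩ := (mem_relSobolev_iff u).1 hu (θ ^ p) (by positivity)
  have hφm : Measurable φ := hφ.1.continuous.measurable
  -- Adding `w` replaces `u` by `φ` on `B` only. Outside `B` the energy gives no control of `φ - u`
  -- in `L^p`, so `u` is kept there.
  set w : LpOn Ω p := cutoff hBm (hφ.memLp.toLp φ - u) with hw
  have hwB : zeroExt w =ᵐ[volume.restrict (relBall Ω c t)] fun x => φ x - zeroExt u x := by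
    filter_upwards [zeroExt_cutoff_restrict hBm (hφ.memLp.toLp φ - u),
      ae_restrict_of_ae (zeroExt_sub (hφ.memLp.toLp φ) u),
      ae_restrict_of_ae (hφ.zeroExt_toLp (p := p))] with x h1 h2 h3
    rw [h1, h2, h3]
  have hxB : zeroExt (u + w) =ᵐ[volume.restrict (relBall Ω c t)] φ := by
    filter_upwards [hwB, ae_restrict_of_ae (zeroExt_add u w)] with x h1 h2
    rw [h2, h1, add_sub_cancel]
  have hwE : energy (relBall Ω c t) s p (zeroExt w) ≤ ENNReal.ofReal (θ ^ p) := by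
    rw [energy_congr_on hwB, energy_sub_comm]
    exact hφu
  have hmem : ∀ r, u + w ∈ relSobolev Ω c t p r := hφ.mem_relSobolev hxB
  have hws : w ∈ relSobolev Ω c t p s := by
    simpa using Submodule.sub_mem _ (hmem s) hu
  refine ⟨u + w, ?_, ?_⟩
  · rw [dist_eq_norm, add_sub_cancel_left, ← Real.rpow_lt_rpow_iff (norm_nonneg _) hδ.le hp0]
    have hzero : ∀ᵐ x, x ∉ relBall Ω c t → zeroExt w x = 0 := by
      filter_upwards [zeroExt_cutoff hBm (hφ.memLp.toLp φ - u)] with x h1 h2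
      rw [h1, Set.indicator_of_notMem h2]
    have h1 := (ofReal_norm_rpow_of_ae_eq_zero hp.out hBm hzero).trans_le
      ((hP _ (measurable_zeroExt w) fun x hx => zeroExt_of_notMem w hx).trans
        (mul_le_mul_right hwE _))
    rw [← ENNReal.ofReal_mul hP0, ENNReal.ofReal_le_ofReal_iff (by positivity)] at h1
    exact h1.trans_lt hθ1
  · have hφfin := hφ.energy_lt_top hN hp.out c (t * Metric.diam (Ω : Set (E N)) / 2) hs1
    have htend := (ENNReal.tendsto_toReal hφfin.ne).comp (hφ.tendsto_energy hN hp.out c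
      (t * Metric.diam (Ω : Set (E N)) / 2) hs' (fun j => ⟨hσ j, hσ' j⟩) hlim)
    have hφX : (energy (relBall Ω c t) s p φ).toReal ≤ (X ^ (1 / p) + θ) ^ p := by
      have h1 := energy_rpow_add_le (B := relBall Ω c t) (s := s) hp.out (measurable_zeroExt u)
        (measurable_zeroExt w)
      rw [← energy_congr (zeroExt_add u w), energy_congr_on hxB] at h1
      have h2 := h1.trans (add_le_add_right (ENNReal.rpow_le_rpow hwE (by positivity)) _)
      rw [← ENNReal.ofReal_toReal hfin, ENNReal.ofReal_rpow_of_nonneg hX0 (by positivity),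
        ENNReal.ofReal_rpow_of_nonneg (by positivity) (by positivity), ← Real.rpow_mul hθ.le,
        mul_one_div_cancel hp0.ne', Real.rpow_one, ← ENNReal.ofReal_add (by positivity) hθ.le] at h2
      have h3 := ENNReal.rpow_le_rpow h2 hp0.le
      rw [← ENNReal.rpow_mul, one_div_mul_cancel hp0.ne', ENNReal.rpow_one,
        ENNReal.ofReal_rpow_of_nonneg (by positivity) hp0.le] at h3
      exact ENNReal.toReal_le_of_le_ofReal (by positivity) h3
    have hfw : f ⟨u + w, hmem s⟩ ≤ f ⟨u, hu⟩ + C * θ := by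
      have h1 := hC ⟨w, hws⟩ (θ ^ p) (by positivity) hwE
      rw [← Real.rpow_mul hθ.le, mul_one_div_cancel hp0.ne', Real.rpow_one] at h1
      have h2 : f ⟨u + w, hmem s⟩ = f ⟨u, hu⟩ + f ⟨w, hws⟩ := by
        rw [← map_add]
        rfl
      linarith [le_abs_self (f ⟨w, hws⟩)]
    have hlt : (energy (relBall Ω c t) s p φ).toReal < p * (X / p + δ - C * θ) := by
      refine hφX.trans_lt ?_
      rw [← div_lt_iff₀' hp0]
      linarith
    filter_upwards [htend.eventually_lt_const hlt] with j hj
    have hjfin : energy (relBall Ω c t) (σ j) p (zeroExt (u + w)) ≠ ∞ := by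
      rw [energy_congr_on hxB]
      exact (hφ.energy_lt_top hN hp.out _ _ ((hσ' j).trans_lt hs')).ne
    refine (functionalF_le_coe_iff _ _ _).2 ⟨hmem _, hjfin, ?_⟩
    rw [energy_congr_on hxB]
    change (energy (relBall Ω c t) (σ j) p φ).toReal < _ at hj
    rw [← div_lt_iff₀' hp0] at hj
    change _ + f ⟨u + w, hmem s⟩ ≤ _
    linarith

end main

end FracGamma

theorem mainTheorem3 {N : ℕ} (hN : 1 ≤ N)
    (Ω : TopologicalSpace.Opens (FracGamma.E N))
    (hne : (Ω : Set (FracGamma.E N)).Nonempty)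
    (hbdd : Bornology.IsBounded (Ω : Set (FracGamma.E N)))
    (c : FracGamma.E N) (hc : FracGamma.IsSmallestBallCenter (Ω : Set (FracGamma.E N)) c)
    (t : ℝ) (ht : 1 < t) (p : ℝ) [hp : Fact (1 < p)]
    (s : ℝ) (hs : 0 < s) (hs1 : s < 1)
    (f : FracGamma.relSobolev Ω c t p s →ₗ[ℝ] ℝ) (hf : FracGamma.IsBoundedFunctional f)
    (σ : ℕ → ℝ) (hσ : ∀ j, σ j ∈ Set.Ioo (0 : ℝ) 1) (hanti : Antitone σ)
    (hlim : Filter.Tendsto σ Filter.atTop (nhds s)) :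
    let F : ℕ → FracGamma.LpOn Ω p → EReal := fun j =>
      FracGamma.functionalF (f ∘ₗ Submodule.inclusion
        (FracGamma.relSobolev_anti Ω c t p (hanti.le_of_tendsto hlim j)))
    FracGamma.EquiCoercive F ∧
      ∀ u : FracGamma.LpOn Ω p,
        (∃ ε : ℝ, 0 < ε ∧
          FracGamma.energy (FracGamma.relBall Ω c t) (s + ε) p (FracGamma.zeroExt u) < ⊤) →
        FracGamma.GammaConvergesAt F (FracGamma.functionalF f) u := by
  have hle : ∀ j, s ≤ σ j := fun j => hanti.le_of_tendsto hlim j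
  intro F
  refine ⟨hf.equiCoercive hN hne hbdd ht hs hle hlim, fun u _ => ⟨fun v hv => ?_, ?_⟩⟩
  · exact hf.le_liminf hN hne hbdd ht hle hlim hv
  -- The first order `σ 0 < 1` bounds the whole non-increasing sequence and serves as the dominating
  -- order.
  · exact hf.exists_recovery hN hne hbdd ht hs (hσ 0).2 hle (fun j => hanti (Nat.zero_le j)) hlim u
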